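/- Let $K$ be a field, $x\in K$, $k\ge 1$ and $0\le r\le k$. A Motzkin $k$-diagram consists of two rows of $k$ vertices in which each vertex is joined to at most one other vertex, the edges being drawable inside the rectangle without crossings; its rank is the number of its vertical edges. The Motzkin algebra $\mathsf M_k(x)$ is the free $K$-module with basis the Motzkin $k$-diagrams and product $d_1d_2=x^{\kappa(d_1,d_2)}d_3$, where $d_1$ is placed above $d_2$, the bottom row of $d_1$ is identified with the top row of $d_2$, $d_3$ is the diagram formed by the resulting connections among the top and bottom vertices, and $\kappa(d_1,d_2)$ is the number of closed loops in the middle row. Let $\mathsf J_{r-1}$ be the span of the diagrams of rank less than $r$. A Motzkin path of length $k$ and rank $r$ is a sequence $(a_1,\dots,a_k)$ with $a_i\in\{-1,0,1\}$, all partial sums nonnegative and total sum $r$. Let $\mathcal P_k^r$ be the set of these paths and $\mathsf m_{k,r}=|\mathcal P_k^r|$. For $a_i=1$, let $j>i$ be the smallest index, if there is one, with $a_i+\cdots+a_j=0$; then $i,j$ are paired. For $p,q\in\mathcal P_k^r$, let $d^p_q$ be the Motzkin diagram whose top horizontal edges join the paired indices of $p$, whose bottom horizontal edges join the paired indices of $q$,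 and whose vertical edges join the $r$ unpaired $1$'s of $p$ to those of $q$ in order from left to right. The cell module $\mathsf C_k^{(r)}$ has $K$-basis $\mathcal P_k^r$ and carries the bilinear form determined by $d^p_p\,d^q_q\equiv\langle p,q\rangle\, d^p_q \pmod{\mathsf J_{r-1}}$. Let $\mathsf G_k^{(r)}=(\langle p,q\rangle)_{p,q\in\mathcal P_k^r}$ be its Gram matrix. Let $u_0(t)=1$, $u_1(t)=t$, $u_n(t)=t\,u_{n-1}(t)-u_{n-2}(t)$ (Chebyshev polynomials of the second kind, rescaled). **Theorem.** $$\det \mathsf G_k^{(r)}=\prod_{s=1}^{\lfloor (k-r)/2\rfloor}\left(\frac{u_{s+r}(x-1)}{u_{s-1}(x-1)}\right)^{\mathsf m_{k,r+2s}}.$$ Here the right-hand side is understood as follows. For an indeterminate $X$, the rational function $\prod_{s}\left(u_{s+r}(X-1)/u_{s-1}(X-1)\right)^{\mathsf m_{k,r+2s}}$ is a polynomial $P\in K[X]$, and $\det \mathsf G_k^{(r)}=P(x)$ for every $x\in K$. In particular, the displayed formula holds literally in $K$ for every $x$ with $u_{s-1}(x-1)\ne 0$ for all $1\le s\le\lfloor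 (k-r)/2\rfloor$. -/

import Mathlib

open Polynomial

namespace Motzkin

/-- Position of a vertex of the rectangle when its boundary is read from the top left corner:
the top row (`inl`) from left to right, then the bottom row (`inr`) from right to left. -/
def pos {k : ℕ} : Fin k ⊕ Fin k → ℕ
  | .inl i => i
  | .inr i => 2 * k - 1 - i

/-- A Motzkin `k`-diagram: a graph on two rows of `k` vertices (`inl` the top row, `inr` the
bottom row) in which each vertex is joined to at most one other vertex, and which is planar: no two
edges cross when drawn as chords inside the rectangle. -/
@[ext]
structure Diagram (k : ℕ) where
  graph : SimpleGraph (Fin k ⊕ Fin k)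
  unique : ∀ a b c, graph.Adj a b → graph.Adj a c → b = c
  planar : ∀ a b c d, graph.Adj a c → graph.Adj b d →
    pos a < pos b → pos b < pos c → ¬ pos c < pos d

/-- The three rows of vertices of the concatenation of two diagrams. -/
abbrev Rows (k : ℕ) := Fin k ⊕ Fin k ⊕ Fin k

/-- The top and bottom rows of the upper diagram are the first and second row. -/
def upper {k : ℕ} : Fin k ⊕ Fin k → Rows k
  | .inl i => .inl i
  | .inr i => .inr (.inl i)

/-- The top and bottom rows of the lower diagram are the second and third row. -/
def lower {k : ℕ} : Fin k ⊕ Fin k → Rows k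
  | .inl i => .inr (.inl i)
  | .inr i => .inr (.inr i)

/-- The top and bottom rows of the product are the first and third row. -/
def outer {k : ℕ} : Fin k ⊕ Fin k → Rows k
  | .inl i => .inl i
  | .inr i => .inr (.inr i)

/-- The concatenation: `d₁` above `d₂`, the bottom row of `d₁` identified with the top row
of `d₂`. -/
def stack {k : ℕ} (d₁ d₂ : Diagram k) : SimpleGraph (Rows k) :=
  d₁.graph.map upper ⊔ d₂.graph.map lower

section Comp

variable {k : ℕ} (d₁ d₂ : Diagram k)

theorem upper_injective : Function.Injective (upper (k := k)) := by
  rintro (a | a) (b | b) h <;> simp_all [upper]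

theorem lower_injective : Function.Injective (lower (k := k)) := by
  rintro (a | a) (b | b) h <;> simp_all [lower]

theorem outer_injective : Function.Injective (outer (k := k)) := by
  rintro (a | a) (b | b) h <;> simp_all [outer]

theorem pos_injective : Function.Injective (pos (k := k)) := by
  rintro (a | a) (b | b) h <;> simp only [pos] at h <;>
    simp only [Sum.inl.injEq, Sum.inr.injEq, Fin.ext_iff, reduceCtorEq] <;> omega

theorem stack_adj {v w : Rows k} : (stack d₁ d₂).Adj v w ↔
    (∃ a b, d₁.graph.Adj a b ∧ upper a = v ∧ upper b = w) ∨
      (∃ a b, d₂.graph.Adj a b ∧ lower a = v ∧ lower b = w) := by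
  simp only [stack, SimpleGraph.sup_adj, SimpleGraph.map_adj']
  constructor
  · rintro (h | h)
    exacts [Or.inl h.2, Or.inr h.2]
  · rintro (⟨a, b, h, rfl, rfl⟩ | ⟨a, b, h, rfl, rfl⟩)
    · exact Or.inl ⟨upper_injective.ne h.ne, a, b, h, rfl, rfl⟩
    · exact Or.inr ⟨lower_injective.ne h.ne, a, b, h, rfl, rfl⟩

/-- Each vertex of the concatenation has at most two neighbours. -/
theorem stack_deg {v w₁ w₂ w₃ : Rows k} (h₁ : (stack d₁ d₂).Adj v w₁)
    (h₂ : (stack d₁ d₂).Adj v w₂) (h₃ : (stack d₁ d₂).Adj v w₃)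
    (n₁ : w₁ ≠ w₂) (n₂ : w₁ ≠ w₃) : w₂ = w₃ := by
  rw [stack_adj] at h₁ h₂ h₃
  rcases h₁ with ⟨a₁, b₁, h₁, rfl, rfl⟩ | ⟨a₁, b₁, h₁, rfl, rfl⟩ <;>
  rcases h₂ with ⟨a₂, b₂, h₂, e₂, rfl⟩ | ⟨a₂, b₂, h₂, e₂, rfl⟩ <;>
  rcases h₃ with ⟨a₃, b₃, h₃, e₃, rfl⟩ | ⟨a₃, b₃, h₃, e₃, rfl⟩
  · cases upper_injective e₂; exact absurd (congrArg _ (d₁.unique _ _ _ h₁ h₂)) n₁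
  · cases upper_injective e₂; exact absurd (congrArg _ (d₁.unique _ _ _ h₁ h₂)) n₁
  · cases upper_injective e₃; exact absurd (congrArg _ (d₁.unique _ _ _ h₁ h₃)) n₂
  · cases lower_injective (e₂.trans e₃.symm); exact congrArg _ (d₂.unique _ _ _ h₂ h₃)
  · cases upper_injective (e₂.trans e₃.symm); exact congrArg _ (d₁.unique _ _ _ h₂ h₃)
  · cases lower_injective e₃; exact absurd (congrArg _ (d₂.unique _ _ _ h₁ h₃)) n₂
  · cases lower_injective e₂; exact absurd (congrArg _ (d₂.unique _ _ _ h₁ h₂)) n₁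
  · cases lower_injective e₂; exact absurd (congrArg _ (d₂.unique _ _ _ h₁ h₂)) n₁

/-- A vertex of the concatenation with at most one neighbour. -/
def IsEnd (v : Rows k) : Prop :=
  ∀ w w', (stack d₁ d₂).Adj v w → (stack d₁ d₂).Adj v w' → w = w'

theorem isEnd_outer (a : Fin k ⊕ Fin k) : IsEnd d₁ d₂ (outer a) := by
  intro w w' h₁ h₂
  rw [stack_adj] at h₁ h₂
  rcases h₁ with ⟨b, c, h, e, rfl⟩ | ⟨b, c, h, e, rfl⟩ <;>
  rcases h₂ with ⟨b', c', h', e', rfl⟩ | ⟨b', c', h', e', rfl⟩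
  · cases upper_injective (e.trans e'.symm); exact congrArg _ (d₁.unique _ _ _ h h')
  · rcases a with a | a <;> rcases b with b | b <;> rcases b' with b' | b' <;>
      simp_all [upper, lower, outer]
  · rcases a with a | a <;> rcases b with b | b <;> rcases b' with b' | b' <;>
      simp_all [upper, lower, outer]
  · cases lower_injective (e.trans e'.symm); exact congrArg _ (d₂.unique _ _ _ h h')

theorem isEnd_mid_of_not_upper (i : Fin k) (hn : ¬ ∃ b, d₁.graph.Adj (.inr i) b) :
    IsEnd d₁ d₂ (.inr (.inl i)) := by
  intro w w' h₁ h₂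
  rw [stack_adj] at h₁ h₂
  rcases h₁ with ⟨b, c, h, e, rfl⟩ | ⟨b, c, h, e, rfl⟩ <;>
  rcases h₂ with ⟨b', c', h', e', rfl⟩ | ⟨b', c', h', e', rfl⟩
  · cases upper_injective (e.trans e'.symm); exact congrArg _ (d₁.unique _ _ _ h h')
  · obtain rfl := upper_injective (a₂ := .inr i) e; exact absurd ⟨_, h⟩ hn
  · obtain rfl := upper_injective (a₂ := .inr i) e'; exact absurd ⟨_, h'⟩ hn
  · cases lower_injective (e.trans e'.symm); exact congrArg _ (d₂.unique _ _ _ h h')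

theorem isEnd_mid_of_not_lower (i : Fin k) (hn : ¬ ∃ b, d₂.graph.Adj (.inl i) b) :
    IsEnd d₁ d₂ (.inr (.inl i)) := by
  intro w w' h₁ h₂
  rw [stack_adj] at h₁ h₂
  rcases h₁ with ⟨b, c, h, e, rfl⟩ | ⟨b, c, h, e, rfl⟩ <;>
  rcases h₂ with ⟨b', c', h', e', rfl⟩ | ⟨b', c', h', e', rfl⟩
  · cases upper_injective (e.trans e'.symm); exact congrArg _ (d₁.unique _ _ _ h h')
  · obtain rfl := lower_injective (a₂ := .inl i) e'; exact absurd ⟨_, h'⟩ hn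
  · obtain rfl := lower_injective (a₂ := .inl i) e; exact absurd ⟨_, h⟩ hn
  · cases lower_injective (e.trans e'.symm); exact congrArg _ (d₂.unique _ _ _ h h')

theorem end_unique_aux {y x v w : Rows k} (hv : IsEnd d₁ d₂ v) (hw : IsEnd d₁ d₂ w)
    (hy : (stack d₁ d₂).Adj x y) (p : (stack d₁ d₂).Walk x v) (q : (stack d₁ d₂).Walk x w)
    (hp : p.IsPath) (hq : q.IsPath) (hyp : y ∉ p.support) (hyq : y ∉ q.support) : v = w := by
  induction p generalizing y with
  | nil =>
    cases q with
    | nil => rfl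
    | cons h q => exact absurd (by simp [hv _ _ hy h]) hyq
  | @cons x z v h p ih =>
    cases q with
    | nil => exact absurd (by simp [hw _ _ hy h]) hyp
    | @cons _ z' _ h' q =>
      have hz : z = z' := by
        refine stack_deg d₁ d₂ hy h h' ?_ ?_
        · rintro rfl; simp at hyp
        · rintro rfl; simp at hyq
      subst hz
      rw [SimpleGraph.Walk.cons_isPath_iff] at hp hq
      exact ih hv h.symm q hp.1 hq.1 hp.2 hq.2

/-- A component of the concatenation has at most two ends. -/
theorem end_unique {u v w : Rows k} (hu : IsEnd d₁ d₂ u) (hv : IsEnd d₁ d₂ v)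
    (hw : IsEnd d₁ d₂ w) (huv : u ≠ v) (huw : u ≠ w) (h₁ : (stack d₁ d₂).Reachable u v)
    (h₂ : (stack d₁ d₂).Reachable u w) : v = w := by
  obtain ⟨p, hp⟩ := h₁.exists_isPath
  obtain ⟨q, hq⟩ := h₂.exists_isPath
  cases p with
  | nil => exact absurd rfl huv
  | cons h p =>
    cases q with
    | nil => exact absurd rfl huw
    | cons h' q =>
      obtain rfl := hu _ _ h h'
      rw [SimpleGraph.Walk.cons_isPath_iff] at hp hq
      exact end_unique_aux d₁ d₂ hv hw h.symm p q hp.1 hq.1 hp.2 hq.2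

theorem chord_parity {p p' q q' : ℕ} (m1 : p ≠ q) (m2 : p' ≠ q) (m3 : p ≠ q') (m4 : p' ≠ q')
    (c1 : p < q → q < p' → ¬ p' < q') (c2 : p < q' → q' < p' → ¬ p' < q)
    (c3 : p' < q → q < p → ¬ p < q') (c4 : p' < q' → q' < p → ¬ p < q)
    (c5 : q < p → p < q' → ¬ q' < p') (c6 : q < p' → p' < q' → ¬ q' < p)
    (c7 : q' < p → p < q → ¬ q < p') (c8 : q' < p' → p' < q → ¬ q < p) :
    ((if p < q then 1 else 0) + (if p' < q then 1 else 0) +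
      ((if p < q' then 1 else 0) + (if p' < q' then 1 else 0)) : ZMod 2) = 0 := by
  rcases lt_or_gt_of_ne m1 with h1 | h1 <;> rcases lt_or_gt_of_ne m2 with h2 | h2 <;>
    rcases lt_or_gt_of_ne m3 with h3 | h3 <;> rcases lt_or_gt_of_ne m4 with h4 | h4 <;>
    simp only [h1, h2, h3, h4, h1.not_gt, h2.not_gt, h3.not_gt, h4.not_gt, if_true, if_false,
      not_true, not_false_eq_true, imp_false, imp_true_iff]
      at c1 c2 c3 c4 c5 c6 c7 c8 ⊢ <;>
    decide

open Classical in
/-- Crossing parity: two disjoint unions of edges of a diagram have an even number of inversions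
along the boundary. -/
theorem inversions_eq_zero (d : Diagram k) (α β : Fin k ⊕ Fin k → ZMod 2)
    (hα : ∀ a, α a ≠ 0 → ∃ b, d.graph.Adj a b) (hβ : ∀ a, β a ≠ 0 → ∃ b, d.graph.Adj a b)
    (hα' : ∀ a b, d.graph.Adj a b → α a = α b) (hβ' : ∀ a b, d.graph.Adj a b → β a = β b)
    (hαβ : ∀ a, α a ≠ 0 → β a = 0) :
    ∑ a, ∑ b, α a * β b * (if pos a < pos b then 1 else 0) = 0 := by
  choose! f hf using hα
  choose! g hg using hβ
  have h2 : ∀ z : ZMod 2, z + z = 0 := by decide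
  refine Finset.sum_involution (fun a _ => if α a ≠ 0 then f a else a) ?_ ?_ ?_ ?_
  · intro a _
    by_cases ha : α a = 0
    · simp [ha]
    · simp only [ne_eq, ha, not_false_eq_true, if_true]
      rw [← hα' _ _ (hf a ha), ← Finset.sum_add_distrib]
      refine Finset.sum_involution (fun b _ => if β b ≠ 0 then g b else b) ?_ ?_ ?_ ?_
      · intro b _
        by_cases hb : β b = 0
        · simp [hb]
        · simp only [ne_eq, hb, not_false_eq_true, if_true]
          rw [← hβ' _ _ (hg b hb)]
          have hA := hf a ha
          have hB := hg b hb
          have n1 : ∀ u v, α u ≠ 0 → β v ≠ 0 → pos u ≠ pos v := fun u v hu hv e =>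
            hv (pos_injective e ▸ hαβ _ hu)
          have ha' : α (f a) ≠ 0 := hα' _ _ hA ▸ ha
          have hb' : β (g b) ≠ 0 := hβ' _ _ hB ▸ hb
          have m1 := n1 _ _ ha hb
          have m2 := n1 _ _ ha' hb
          have m3 := n1 _ _ ha hb'
          have m4 := n1 _ _ ha' hb'
          have e1 : α a = 1 := by revert ha; generalize α a = z; revert z; decide
          have e2 : β b = 1 := by revert hb; generalize β b = z; revert z; decide
          rw [e1, e2]
          have := chord_parity m1 m2 m3 m4 (d.planar _ _ _ _ hA hB) (d.planar _ _ _ _ hA hB.symm)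
            (d.planar _ _ _ _ hA.symm hB) (d.planar _ _ _ _ hA.symm hB.symm)
            (d.planar _ _ _ _ hB hA) (d.planar _ _ _ _ hB hA.symm)
            (d.planar _ _ _ _ hB.symm hA) (d.planar _ _ _ _ hB.symm hA.symm)
          simpa only [one_mul] using this
      · intro b _ h
        by_cases hb : β b = 0
        · simp [hb] at h
        · simpa [hb] using (hg b hb).ne'
      · simp
      · intro b _
        by_cases hb : β b = 0
        · simp [hb]
        · have hb' : β (g b) ≠ 0 := hβ' _ _ (hg b hb) ▸ hb
          simp only [ne_eq, hb, not_false_eq_true, if_true, hb']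
          exact d.unique _ _ _ (hg _ hb') (hg _ hb).symm
  · intro a _ h
    by_cases ha : α a = 0
    · simp [ha] at h
    · simpa [ha] using (hf a ha).ne'
  · simp
  · intro b _
    by_cases hb : α b = 0
    · simp [hb]
    · have hb' : α (f b) ≠ 0 := hα' _ _ (hf b hb) ▸ hb
      simp only [ne_eq, hb, not_false_eq_true, if_true, hb']
      exact d.unique _ _ _ (hf _ hb') (hf _ hb).symm

theorem total_eq_zero (d : Diagram k) (α : Fin k ⊕ Fin k → ZMod 2)
    (hα : ∀ a, α a ≠ 0 → ∃ b, d.graph.Adj a b)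
    (hα' : ∀ a b, d.graph.Adj a b → α a = α b) : ∑ a, α a = 0 := by
  classical
  choose! f hf using hα
  have h2 : ∀ z : ZMod 2, z + z = 0 := by decide
  refine Finset.sum_involution (fun a _ => if α a ≠ 0 then f a else a) ?_ ?_ ?_ ?_
  · intro a _
    by_cases ha : α a = 0
    · simp [ha]
    · simp only [ne_eq, ha, not_false_eq_true, if_true]
      rw [← hα' _ _ (hf a ha), h2]
  · intro a _ ha
    simpa [ha] using (hf a ha).ne'
  · simp
  · intro b _
    by_cases hb : α b = 0
    · simp [hb]
    · have hb' : α (f b) ≠ 0 := hα' _ _ (hf b hb) ▸ hb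
      simp only [ne_eq, hb, not_false_eq_true, if_true, hb']
      exact d.unique _ _ _ (hf _ hb') (hf _ hb).symm

theorem exists_adj_of_reachable {V : Type*} {G : SimpleGraph V} {u v w : V} (hv : G.Reachable u v)
    (hw : G.Reachable u w) (hne : v ≠ w) : ∃ z, G.Adj v z := by
  obtain ⟨p⟩ := hv.symm.trans hw
  cases p with
  | nil => exact absurd rfl hne
  | cons h _ => exact ⟨_, h⟩

/-- A strand joining two outer vertices runs through edges of both diagrams only. -/
theorem strand_upper {a c : Fin k ⊕ Fin k} (hac : a ≠ c)
    (h : (stack d₁ d₂).Reachable (outer a) (outer c)) (v : Fin k ⊕ Fin k)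
    (hv : (stack d₁ d₂).Reachable (outer a) (upper v)) : ∃ b, d₁.graph.Adj v b := by
  have hac' := outer_injective.ne hac
  rcases v with i | i
  · have : ∃ z, (stack d₁ d₂).Adj (.inl i) z := by
      by_cases e : outer a = .inl i
      · exact exists_adj_of_reachable hv h (e ▸ hac')
      · exact exists_adj_of_reachable hv (SimpleGraph.Reachable.refl _) (Ne.symm e)
    obtain ⟨z, hz⟩ := this
    rw [stack_adj] at hz
    rcases hz with ⟨u, w, huw, e, rfl⟩ | ⟨u, w, huw, e, rfl⟩
    · obtain rfl := upper_injective (a₂ := .inl i) e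
      exact ⟨_, huw⟩
    · rcases u with u | u <;> simp [lower] at e
  · by_contra hn
    have he := isEnd_mid_of_not_upper d₁ d₂ i hn
    have := end_unique d₁ d₂ (isEnd_outer d₁ d₂ a) (isEnd_outer d₁ d₂ c) he hac'
      (by rcases a with a | a <;> simp [outer]) h hv
    rcases c with c | c <;> simp [outer] at this

theorem strand_lower {a c : Fin k ⊕ Fin k} (hac : a ≠ c)
    (h : (stack d₁ d₂).Reachable (outer a) (outer c)) (v : Fin k ⊕ Fin k)
    (hv : (stack d₁ d₂).Reachable (outer a) (lower v)) : ∃ b, d₂.graph.Adj v b := by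
  have hac' := outer_injective.ne hac
  rcases v with i | i
  · by_contra hn
    have he := isEnd_mid_of_not_lower d₁ d₂ i hn
    have := end_unique d₁ d₂ (isEnd_outer d₁ d₂ a) (isEnd_outer d₁ d₂ c) he hac'
      (by rcases a with a | a <;> simp [outer]) h hv
    rcases c with c | c <;> simp [outer] at this
  · have : ∃ z, (stack d₁ d₂).Adj (.inr (.inr i)) z := by
      by_cases e : outer a = .inr (.inr i)
      · exact exists_adj_of_reachable hv h (e ▸ hac')
      · exact exists_adj_of_reachable hv (SimpleGraph.Reachable.refl _) (Ne.symm e)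
    obtain ⟨z, hz⟩ := this
    rw [stack_adj] at hz
    rcases hz with ⟨u, w, huw, e, rfl⟩ | ⟨u, w, huw, e, rfl⟩
    · rcases u with u | u <;> simp [upper] at e
    · obtain rfl := lower_injective (a₂ := .inr i) e
      exact ⟨_, huw⟩

theorem stack_adj_upper {v w : Fin k ⊕ Fin k} (h : d₁.graph.Adj v w) :
    (stack d₁ d₂).Adj (upper v) (upper w) :=
  (stack_adj d₁ d₂).2 (Or.inl ⟨v, w, h, rfl, rfl⟩)

theorem stack_adj_lower {v w : Fin k ⊕ Fin k} (h : d₂.graph.Adj v w) :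
    (stack d₁ d₂).Adj (lower v) (lower w) :=
  (stack_adj d₁ d₂).2 (Or.inr ⟨v, w, h, rfl, rfl⟩)

/-- Crossing parity for three rows. -/
theorem outer_inversions_eq_zero (α β : Rows k → ZMod 2)
    (h₁ : ∑ a, ∑ b, α (upper a) * β (upper b) * (if pos a < pos b then 1 else 0) = 0)
    (h₂ : ∑ a, ∑ b, α (lower a) * β (lower b) * (if pos a < pos b then 1 else 0) = 0)
    (s₁ : ∑ a, α (upper a) = 0) (s₂ : ∑ a, α (lower a) = 0)
    (t₂ : ∑ a, β (lower a) = 0)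
    (hαβ : ∀ v, α v ≠ 0 → β v = 0) :
    ∑ a, ∑ b, α (outer a) * β (outer b) * (if pos a < pos b then 1 else 0) = 0 := by
  obtain ⟨χ, hχ⟩ : ∃ χ : ℕ → ℕ → ZMod 2, ∀ m n, χ m n = if m < n then 1 else 0 :=
    ⟨_, fun _ _ => rfl⟩
  have q1 : ∀ i j : Fin k, χ i (2 * k - 1 - j) = 1 := fun i j => by
    rw [hχ, if_pos (by omega)]
  have q2 : ∀ i j : Fin k, χ (2 * k - 1 - i) j = 0 := fun i j => by
    rw [hχ, if_neg (by omega)]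
  have q3 : ∀ i j : Fin k, χ (2 * k - 1 - i) (2 * k - 1 - j) = χ j i := fun i j => by
    rw [hχ, hχ]; congr 1; apply propext; omega
  simp only [← hχ] at h₁ h₂ ⊢
  simp only [Fintype.sum_sum_type, upper, lower, outer, pos, q1, q2, q3,
    mul_one, mul_zero, Finset.sum_const_zero, add_zero, Finset.sum_add_distrib,
    ← Finset.mul_sum, ← Finset.sum_mul] at h₁ h₂ s₁ s₂ t₂ ⊢
  have hm : (∑ i : Fin k, ∑ j : Fin k, α (.inr (.inl i)) * β (.inr (.inl j)) *
        χ i j) +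
      (∑ i : Fin k, ∑ j : Fin k, α (.inr (.inl i)) * β (.inr (.inl j)) *
        χ j i) =
      (∑ i : Fin k, α (.inr (.inl i))) * ∑ j : Fin k, β (.inr (.inl j)) := by
    rw [Finset.sum_mul_sum, ← Finset.sum_add_distrib]
    refine Finset.sum_congr rfl fun i _ => ?_
    rw [← Finset.sum_add_distrib]
    refine Finset.sum_congr rfl fun j _ => ?_
    rcases lt_trichotomy (i : ℕ) j with hij | hij | hij
    · simp [hχ, hij, hij.not_gt]
    · obtain rfl := Fin.ext hij
      by_cases ha : α (.inr (.inl i)) = 0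
      · simp [ha]
      · simp [hαβ _ ha]
    · simp [hχ, hij, hij.not_gt]
  revert h₁ h₂ s₁ s₂ t₂ hm
  generalize (∑ i : Fin k, ∑ j : Fin k, α (.inr (.inl i)) * β (.inr (.inl j)) *
        χ i j) = z1
  generalize (∑ i : Fin k, ∑ j : Fin k, α (.inr (.inl i)) * β (.inr (.inl j)) *
        χ j i) = z2
  generalize (∑ i : Fin k, α (.inr (.inl i))) = z3
  generalize (∑ i : Fin k, β (.inr (.inl i))) = z4
  generalize (∑ i : Fin k, α (.inr (.inr i))) = z5
  generalize (∑ i : Fin k, β (.inr (.inr i))) = z6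
  generalize (∑ i : Fin k, α (.inl i)) = z7
  generalize (∑ i : Fin k, β (.inl i)) = z8
  intro e1 e2 e3 e4 e6 e7
  have w : ∀ z : ZMod 2, z + z = 0 := by decide
  have f3 : z3 = z7 := by linear_combination e3 - w z7
  have f5 : z5 = z7 := by linear_combination e4 - e3
  have f4 : z4 = z6 := by linear_combination e6 - w z6
  rw [f3, f4] at e7
  rw [f4] at e1
  rw [f3] at e2
  linear_combination e1 + e2 - e7 - w (z7 * z6)

open Classical in
/-- The diagram underlying the product: two vertices are joined when a strand of the
concatenation connects them. -/
def comp : Diagram k where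
  graph :=
    { Adj := fun a b => a ≠ b ∧ (stack d₁ d₂).Reachable (outer a) (outer b)
      symm := ⟨fun _ _ h => ⟨h.1.symm, h.2.symm⟩⟩
      loopless := ⟨fun _ h => h.1 rfl⟩ }
  unique a b c hb hc := outer_injective <| end_unique d₁ d₂ (isEnd_outer d₁ d₂ a)
    (isEnd_outer d₁ d₂ b) (isEnd_outer d₁ d₂ c) (outer_injective.ne hb.1) (outer_injective.ne hc.1)
    hb.2 hc.2
  planar := by
    rintro a b c d ⟨hac, rac⟩ ⟨hbd, rbd⟩ h1 h2 h3
    have only : ∀ {a c}, a ≠ c → (stack d₁ d₂).Reachable (outer a) (outer c) →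
        ∀ v, (stack d₁ d₂).Reachable (outer a) (outer v) ↔ v = a ∨ v = c := by
      intro a c hac rac v
      constructor
      · intro hv
        by_contra hn
        push Not at hn
        exact hn.2 (outer_injective (end_unique d₁ d₂ (isEnd_outer d₁ d₂ a) (isEnd_outer d₁ d₂ c)
          (isEnd_outer d₁ d₂ v) (outer_injective.ne hac) (outer_injective.ne hn.1.symm)
          rac hv)).symm
      · rintro (rfl | rfl)
        exacts [SimpleGraph.Reachable.refl _, rac]
    have hab : ¬ (stack d₁ d₂).Reachable (outer a) (outer b) := by
      rw [only hac rac]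
      rintro (rfl | rfl) <;> omega
    let α : Rows k → ZMod 2 := fun v => if (stack d₁ d₂).Reachable (outer a) v then 1 else 0
    let β : Rows k → ZMod 2 := fun v => if (stack d₁ d₂).Reachable (outer b) v then 1 else 0
    have hα : ∀ v, α v ≠ 0 → (stack d₁ d₂).Reachable (outer a) v := fun v hv => by
      by_contra hn; simp [α, hn] at hv
    have hβ : ∀ v, β v ≠ 0 → (stack d₁ d₂).Reachable (outer b) v := fun v hv => by
      by_contra hn; simp [β, hn] at hv
    have hαe : ∀ v w, (stack d₁ d₂).Adj v w → α v = α w := fun v w hvw => by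
      have : (stack d₁ d₂).Reachable (outer a) v ↔ (stack d₁ d₂).Reachable (outer a) w :=
        ⟨fun h => h.trans hvw.reachable, fun h => h.trans hvw.symm.reachable⟩
      simp only [α, this]
    have hβe : ∀ v w, (stack d₁ d₂).Adj v w → β v = β w := fun v w hvw => by
      have : (stack d₁ d₂).Reachable (outer b) v ↔ (stack d₁ d₂).Reachable (outer b) w :=
        ⟨fun h => h.trans hvw.reachable, fun h => h.trans hvw.symm.reachable⟩
      simp only [β, this]
    have hαβ : ∀ v, α v ≠ 0 → β v = 0 := fun v hv => by
      by_contra hn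
      exact hab ((hα v hv).trans (hβ v hn).symm)
    have au := fun v hv => strand_upper d₁ d₂ hac rac v (hα _ hv)
    have al := fun v hv => strand_lower d₁ d₂ hac rac v (hα _ hv)
    have bu := fun v hv => strand_upper d₁ d₂ hbd rbd v (hβ _ hv)
    have bl := fun v hv => strand_lower d₁ d₂ hbd rbd v (hβ _ hv)
    have aue := fun v w hvw => hαe _ _ (stack_adj_upper d₁ d₂ (v := v) (w := w) hvw)
    have ale := fun v w hvw => hαe _ _ (stack_adj_lower d₁ d₂ (v := v) (w := w) hvw)
    have bue := fun v w hvw => hβe _ _ (stack_adj_upper d₁ d₂ (v := v) (w := w) hvw)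
    have ble := fun v w hvw => hβe _ _ (stack_adj_lower d₁ d₂ (v := v) (w := w) hvw)
    have key := outer_inversions_eq_zero α β
      (inversions_eq_zero d₁ (fun v => α (upper v)) (fun v => β (upper v)) au bu aue bue
        fun v => hαβ _)
      (inversions_eq_zero d₂ (fun v => α (lower v)) (fun v => β (lower v)) al bl ale ble
        fun v => hαβ _)
      (total_eq_zero d₁ (fun v => α (upper v)) au aue)
      (total_eq_zero d₂ (fun v => α (lower v)) al ale)
      (total_eq_zero d₂ (fun v => β (lower v)) bl ble) hαβ
    have sum_pair : ∀ {a c : Fin k ⊕ Fin k}, a ≠ c → ∀ F : Fin k ⊕ Fin k → ZMod 2,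
        ∑ v, (if v = a ∨ v = c then 1 else 0) * F v = F a + F c := by
      intro a c hac F
      rw [← Finset.sum_pair hac]
      simp only [ite_mul, one_mul, zero_mul]
      rw [← Finset.sum_filter]
      exact Finset.sum_congr (by ext; simp) fun _ _ => rfl
    simp only [α, β, only hac rac, only hbd rbd, mul_assoc] at key
    simp only [← Finset.mul_sum, sum_pair hac, sum_pair hbd] at key
    rw [if_pos h1, if_pos (h1.trans (h2.trans h3)), if_neg h2.not_gt, if_pos h3] at key
    revert key
    decide

end Comp

/-- The number of closed loops in the middle row of the concatenation: connected components
consisting of middle vertices each of which is an endpoint of an edge of `d₁` and of an edge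
of `d₂`. -/
noncomputable def loops {k : ℕ} (d₁ d₂ : Diagram k) : ℕ :=
  Set.ncard {C : (stack d₁ d₂).ConnectedComponent | ∀ v ∈ C.supp, ∃ i : Fin k,
    v = .inr (.inl i) ∧ (∃ b, d₁.graph.Adj (.inr i) b) ∧ ∃ b, d₂.graph.Adj (.inl i) b}

/-- The rank: the number of vertical edges. -/
noncomputable def Diagram.rank {k : ℕ} (d : Diagram k) : ℕ :=
  Set.ncard {e : Fin k × Fin k | d.graph.Adj (.inl e.1) (.inr e.2)}

/-- A Motzkin path of length `k` and rank `r`: a sequence of steps `-1, 0, 1` with nonnegative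
partial sums and with total `r`. -/
abbrev MotzkinPath (k r : ℕ) :=
  {a : Fin k → SignType // (∀ s, 0 ≤ ∑ i ∈ Finset.Iic s, (a i : ℤ)) ∧ ∑ i, (a i : ℤ) = r}

/-- The number of Motzkin paths of length `k` and rank `r`. -/
def numPaths (k r : ℕ) : ℕ := Fintype.card (MotzkinPath k r)

section Pairing

variable {k : ℕ} (a : Fin k → SignType)

/-- The entries at `i` and `j` are paired: `a i = 1`, `a j = -1`, and `j` is the smallest index
after `i` with `a i + ⋯ + a j = 0`. -/
def Paired (i j : Fin k) : Prop :=
  i < j ∧ a i = 1 ∧ a j = -1 ∧ ∑ l ∈ Finset.Icc i j, (a l : ℤ) = 0 ∧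
    ∀ m, i < m → m < j → ∑ l ∈ Finset.Icc i m, (a l : ℤ) ≠ 0

/-- Horizontal edges of the 1-factor of a path. -/
def Arc (i j : Fin k) : Prop := Paired a i j ∨ Paired a j i

/-- White vertices of the 1-factor of a path: the unpaired entries `1`. -/
def White (i : Fin k) : Prop := a i = 1 ∧ ∀ j, ¬ Paired a i j

open Classical in
/-- The number of white vertices to the left of `i`. -/
noncomputable def whitesBefore (i : Fin k) : ℕ :=
  (Finset.univ.filter fun j => j < i ∧ White a j).card

/-- Height of the path after `n` steps. -/
def height (n : ℕ) : ℤ := ∑ i : Fin k, if (i : ℕ) < n then (a i : ℤ) else 0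

theorem height_zero : height a 0 = 0 := by simp [height]

theorem height_succ (i : Fin k) : height a (i + 1) = height a i + (a i : ℤ) := by
  have : ∀ j : Fin k, (if (j : ℕ) < i + 1 then (a j : ℤ) else 0) =
      (if (j : ℕ) < i then (a j : ℤ) else 0) + if j = i then (a j : ℤ) else 0 := by
    intro j
    rcases lt_trichotomy (j : ℕ) i with h | h | h
    · simp [h, h.trans (Nat.lt_succ_self _), Fin.ext_iff, h.ne]
    · simp [Fin.ext h]
    · simp [h.not_gt, h.ne', Fin.ext_iff, Nat.not_lt.2 (Nat.succ_le_of_lt h)]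
  simp only [height, this, Finset.sum_add_distrib, Finset.sum_ite_eq', Finset.mem_univ, if_true]

theorem sum_Icc_eq (i j : Fin k) (hij : i ≤ j) :
    ∑ l ∈ Finset.Icc i j, (a l : ℤ) = height a (j + 1) - height a i := by
  rw [height, height, ← Finset.sum_sub_distrib, ← Finset.univ_inter (Finset.Icc i j),
    ← Finset.sum_ite_mem]
  refine Finset.sum_congr rfl fun l _ => ?_
  rw [Fin.le_def] at hij
  simp only [Finset.mem_Icc, Fin.le_def]
  by_cases h : (l : ℕ) < i
  · rw [if_neg (by omega), if_pos (by omega), if_pos h, sub_self]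
  · by_cases h' : (l : ℕ) ≤ j
    · rw [if_pos (by omega), if_pos (by omega), if_neg h, sub_zero]
    · rw [if_neg (by omega), if_neg (by omega), if_neg h, sub_zero]

theorem step_cases (i : Fin k) : (a i = 1 ∧ height a (i + 1) = height a i + 1) ∨
    (a i = 0 ∧ height a (i + 1) = height a i) ∨
    (a i = -1 ∧ height a (i + 1) = height a i - 1) := by
  rw [height_succ]
  rcases h : a i with _ | _ | _
  · exact Or.inr (Or.inl ⟨rfl, by simp⟩)
  · exact Or.inr (Or.inr ⟨rfl, by simp; ring⟩)
  · exact Or.inl ⟨rfl, by simp⟩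

theorem height_step {n : ℕ} (hn : n < k) :
    height a n - 1 ≤ height a (n + 1) ∧ height a (n + 1) ≤ height a n + 1 := by
  have := step_cases a ⟨n, hn⟩
  simp only at this
  omega

theorem paired_iff {i j : Fin k} : Paired a i j ↔ i < j ∧ height a (j + 1) = height a i ∧
    ∀ l : ℕ, (i : ℕ) < l → l ≤ j → height a i < height a l := by
  constructor
  · rintro ⟨hij, hi, hj, h0, hm⟩
    refine ⟨hij, by rw [sum_Icc_eq a i j hij.le] at h0; omega, ?_⟩
    intro l hil
    induction l, hil using Nat.le_induction with
    | base =>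
      intro _
      rw [Nat.succ_eq_add_one]
      have := step_cases a i
      rcases this with h | h | h
      · omega
      · simp [hi] at h
      · simp [hi] at h
    | succ l hl ih =>
      intro hlj
      have ih := ih (by omega)
      have hk : l < k := by omega
      have := hm ⟨l, hk⟩ (by rw [Fin.lt_def]; exact hl) (by rw [Fin.lt_def]; exact hlj)
      rw [sum_Icc_eq a _ _ (by rw [Fin.le_def]; exact Nat.le_of_succ_le hl)] at this
      have := height_step a hk
      simp only at *
      omega
  · rintro ⟨hij, h0, hm⟩
    have hij' := hij
    rw [Fin.lt_def] at hij'
    have h1 := hm (i + 1) (by omega) (by omega)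
    have h2 := hm j hij' le_rfl
    refine ⟨hij, ?_, ?_, ?_, ?_⟩
    · rcases step_cases a i with h | h | h
      · exact h.1
      · omega
      · omega
    · rcases step_cases a j with h | h | h
      · omega
      · omega
      · exact h.1
    · rw [sum_Icc_eq a i j hij.le]; omega
    · intro m him hmj
      rw [sum_Icc_eq a i m him.le]
      rw [Fin.lt_def] at him hmj
      have := hm (m + 1) (by omega) (by omega)
      omega

theorem white_iff {i : Fin k} : White a i ↔
    ∀ l : ℕ, (i : ℕ) < l → l ≤ k → height a i < height a l := by
  classical
  constructor
  · rintro ⟨hi, hn⟩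
    by_contra! hc
    have hex : ∃ l : ℕ, (i : ℕ) < l ∧ l ≤ k ∧ height a l ≤ height a i := hc
    obtain ⟨h1, h2, h3⟩ := Nat.find_spec hex
    have hmin : ∀ l, l < Nat.find hex → (i : ℕ) < l → height a i < height a l := by
      intro l hl hil
      have := Nat.find_min hex hl
      push Not at this
      exact this hil (by omega)
    generalize Nat.find hex = n at h1 h2 h3 hmin
    have hs : height a (i + 1) = height a i + 1 := by
      rcases step_cases a i with h | h | h
      · exact h.2
      · simp [hi] at h
      · simp [hi] at h
    have hn1 : n ≠ i + 1 := by rintro rfl; omega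
    obtain ⟨m, rfl⟩ : ∃ m, n = m + 1 := ⟨n - 1, by omega⟩
    have hk : m < k := by omega
    have := height_step a hk
    have := hmin m (by omega) (by omega)
    refine hn ⟨m, hk⟩ ((paired_iff a).2 ⟨by rw [Fin.lt_def]; simp only; omega, ?_, ?_⟩)
    · simp only; omega
    · intro l hl hlm
      simp only at hlm
      exact hmin l (by omega) hl
  · intro h
    refine ⟨?_, fun j hj => ?_⟩
    · have := h (i + 1) (by omega) (by omega)
      rcases step_cases a i with h | h | h
      · exact h.1
      · omega
      · omega
    · obtain ⟨h1, h2, h3⟩ := (paired_iff a).1 hj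
      rw [Fin.lt_def] at h1
      have := h (j + 1) (by omega) (by omega)
      omega

variable {a}

theorem Arc.symm {i j : Fin k} (h : Arc a i j) : Arc a j i := Or.symm h

theorem Arc.paired {i j : Fin k} (h : Arc a i j) (hij : (i : ℕ) < j) : Paired a i j := by
  rcases h with h | h
  · exact h
  · have := h.1
    rw [Fin.lt_def] at this
    omega

theorem Arc.unique {i j l : Fin k} (h : Arc a i j) (h' : Arc a i l) : j = l := by
  unfold Arc at h h'
  simp only [paired_iff, Fin.lt_def] at h h'
  apply Fin.ext
  by_contra hne
  rcases h with ⟨h1, h2, h3⟩ | ⟨h1, h2, h3⟩ <;> rcases h' with ⟨g1, g2, g3⟩ | ⟨g1, g2, g3⟩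
  · rcases Nat.lt_or_gt_of_ne hne with hl | hl
    · have := g3 (j + 1) (by omega) (by omega); omega
    · have := h3 (l + 1) (by omega) (by omega); omega
  · have := g3 i g1 le_rfl
    have := h3 (i + 1) (by omega) (by omega)
    omega
  · have := h3 i h1 le_rfl
    have := g3 (i + 1) (by omega) (by omega)
    omega
  · rcases Nat.lt_or_gt_of_ne hne with hl | hl
    · have := h3 l (by omega) (by omega); omega
    · have := g3 j (by omega) (by omega); omega

theorem White.not_arc {i j : Fin k} (h : White a i) (h' : Arc a i j) : False := by
  rcases h' with h' | h'
  · exact h.2 _ h'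
  · have h := (white_iff a).1 h
    obtain ⟨h1, h2, h3⟩ := (paired_iff a).1 h'
    rw [Fin.lt_def] at h1
    have := h (i + 1) (by omega) (by omega)
    have := h3 i (by omega) le_rfl
    omega

theorem White.not_under {i w j : Fin k} (h : White a w) (h' : Arc a i j) (h₁ : (i : ℕ) < w)
    (h₂ : (w : ℕ) < j) : False := by
  obtain ⟨h1, h2, h3⟩ := (paired_iff a).1 (h'.paired (h₁.trans h₂))
  have := h3 w h₁ h₂.le
  have := (white_iff a).1 h (j + 1) (by omega) (by omega)
  omega

theorem Arc.not_cross {i j i' j' : Fin k} (h : Arc a i j) (h' : Arc a i' j') (h₁ : (i : ℕ) < i')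
    (h₂ : (i' : ℕ) < j) (h₃ : (j : ℕ) < j') : False := by
  obtain ⟨h1, h2, h3⟩ := (paired_iff a).1 (h.paired (h₁.trans h₂))
  obtain ⟨g1, g2, g3⟩ := (paired_iff a).1 (h'.paired (h₂.trans h₃))
  have := h3 i' h₁ h₂.le
  have := g3 (j + 1) (by omega) (by omega)
  omega

theorem Arc.ne {i j : Fin k} (h : Arc a i j) : i ≠ j := by
  rintro rfl
  rcases h with h | h <;> exact absurd h.1 (lt_irrefl _)

theorem White.lt {i j : Fin k} (hi : White a i) (hij : i < j) :
    whitesBefore a i < whitesBefore a j := by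
  classical
  refine Finset.card_lt_card ⟨fun l hl => ?_, fun h => ?_⟩
  · simp only [Finset.mem_filter, Finset.mem_univ, true_and] at hl ⊢
    exact ⟨hl.1.trans hij, hl.2⟩
  · have hm : i ∈ Finset.univ.filter fun l => l < j ∧ White a l := by simp [hij, hi]
    have := h hm
    simp at this

theorem White.eq_of {i j : Fin k} (hi : White a i) (hj : White a j)
    (h : whitesBefore a i = whitesBefore a j) : i = j := by
  rcases lt_trichotomy i j with hl | hl | hl
  · have := hi.lt hl; omega
  · exact hl
  · have := hj.lt hl; omega

end Pairing

/-- Edges of the diagram with top row the 1-factor of `p` and bottom row the 1-factor of `q`: the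
horizontal edges are those of the 1-factors, and the white vertices of `p` are joined to the white
vertices of `q` in the same order from left to right. -/
def edge {k : ℕ} (p q : Fin k → SignType) : Fin k ⊕ Fin k → Fin k ⊕ Fin k → Prop
  | .inl i, .inl j => Arc p i j
  | .inr i, .inr j => Arc q i j
  | .inl i, .inr j => White p i ∧ White q j ∧ whitesBefore p i = whitesBefore q j
  | .inr j, .inl i => White p i ∧ White q j ∧ whitesBefore p i = whitesBefore q j

/-- The Motzkin diagram with top row `p` and bottom row `q`. -/
def diagram {k : ℕ} (p q : Fin k → SignType) : Diagram k where
  graph :=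
    { Adj := edge p q
      symm := ⟨by
        rintro (a | a) (b | b) h
        exacts [h.symm, h, h, h.symm]⟩
      loopless := ⟨by
        rintro (a | a) h
        exacts [h.ne rfl, h.ne rfl]⟩ }
  unique := by
    rintro (a | a) (b | b) (c | c) h h' <;> simp only [edge] at h h'
    · rw [h.unique h']
    · exact (h'.1.not_arc h).elim
    · exact (h.1.not_arc h').elim
    · rw [h.2.1.eq_of h'.2.1 (h.2.2.symm.trans h'.2.2)]
    · rw [h.1.eq_of h'.1 (h.2.2.trans h'.2.2.symm)]
    · exact (h.2.1.not_arc h').elim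
    · exact (h'.2.1.not_arc h).elim
    · rw [h.unique h']
  planar := by
    rintro (a | a) (b | b) (c | c) (d | d) h h' h1 h2 h3 <;> simp only [edge] at h h' <;>
      simp only [pos] at h1 h2 h3 <;> first | omega | skip
    · exact h.not_cross h' h1 h2 h3
    · exact h'.1.not_under h h1 h2
    · have := h.1.lt (Fin.lt_def.2 h1)
      have := h'.2.1.lt (j := c) (Fin.lt_def.2 (by omega))
      omega
    · exact h.2.1.not_under h'.symm (by omega) (by omega)
    · exact h'.symm.not_cross h.symm (by omega) (by omega) (by omega)

section Algebra

variable (K : Type*) [CommRing K]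

/-- The underlying free module of the Motzkin algebra: its basis is the set of Motzkin diagrams. -/
abbrev MotzkinAlgebra (k : ℕ) := Diagram k →₀ K

variable {K}

/-- The multiplication of the Motzkin algebra with parameter `x`: on diagrams
`d₁ d₂ = x ^ κ(d₁, d₂) d₃`, where `κ` is the number of closed loops in the middle row. -/
noncomputable def mul (x : K) {k : ℕ} :
    MotzkinAlgebra K k →ₗ[K] MotzkinAlgebra K k →ₗ[K] MotzkinAlgebra K k :=
  Finsupp.basisSingleOne.constr K fun d₁ => Finsupp.basisSingleOne.constr K fun d₂ =>
    Finsupp.single (comp d₁ d₂) (x ^ loops d₁ d₂)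

variable (K) in
/-- The span of the diagrams of rank less than `r`. -/
noncomputable def rankLT (k r : ℕ) : Submodule K (MotzkinAlgebra K k) :=
  Submodule.span K {a | ∃ d : Diagram k, d.rank < r ∧ a = Finsupp.single d 1}

variable (K) in
/-- The cell module of rank `r`: the free module with basis the Motzkin paths of length `k` and
rank `r`. -/
abbrev CellModule (k r : ℕ) := MotzkinPath k r →₀ K

/-- The Motzkin diagram of two paths as an element of the algebra. -/
noncomputable def pathDiagram {k r : ℕ} (p q : MotzkinPath k r) : MotzkinAlgebra K k :=
  Finsupp.single (diagram p.1 q.1) 1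

/-- The bilinear form of the cell module: for paths `p` and `q`, the value `⟨p, q⟩` is the
coefficient of the diagram with top `p` and bottom `q` in the product of the diagram with top and
bottom `p` and the diagram with top and bottom `q`. By `cellForm_iff` it is the only scalar `c` for
which that product is congruent to `c` times that diagram modulo diagrams of rank less than `r`. -/
noncomputable def cellForm (x : K) (k r : ℕ) : LinearMap.BilinForm K (CellModule K k r) :=
  Finsupp.basisSingleOne.constr K fun p => Finsupp.basisSingleOne.constr K fun q =>
    mul x (pathDiagram p p) (pathDiagram q q) (diagram p.1 q.1)

/-- The Gram matrix of the form in the basis of Motzkin paths. -/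
noncomputable def gramMatrix (x : K) (k r : ℕ) : Matrix (MotzkinPath k r) (MotzkinPath k r) K :=
  LinearMap.BilinForm.toMatrix Finsupp.basisSingleOne (cellForm x k r)

end Algebra

section WellDefined

variable {k r : ℕ}

/-- A path of rank `r` has `r` white vertices. -/
theorem card_white (p : MotzkinPath k r) : Set.ncard {i | White p.1 i} = r := by
  classical
  obtain ⟨a, h0, hr⟩ := p
  simp only
  have hk : height a k = r := by
    rw [← hr, height]
    exact Finset.sum_congr rfl fun i _ => if_pos i.2
  have hnn : ∀ i : Fin k, 0 ≤ height a i := by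
    intro i
    rcases Nat.eq_zero_or_pos (i : ℕ) with h | h
    · rw [h, height_zero]
    · have := h0 ⟨i - 1, by omega⟩
      rw [height, ← Finset.sum_filter]
      convert this using 2
      ext l
      simp only [Finset.mem_filter, Finset.mem_univ, true_and, Finset.mem_Iic, Fin.le_def]
      omega
  have key : Set.ncard {i | White a i} = Set.ncard (Set.Iio r) := by
    refine Set.ncard_congr (fun i _ => (height a i).toNat) ?_ ?_ ?_
    · intro i hi
      have := (white_iff a).1 hi k i.2 le_rfl
      have := hnn i
      simp only [Set.mem_Iio]
      omega
    · intro i j hi hj h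
      have hi := (white_iff a).1 hi
      have hj := (white_iff a).1 hj
      have := hnn i
      have := hnn j
      apply Fin.ext
      by_contra hne
      rcases Nat.lt_or_gt_of_ne hne with hl | hl
      · have := hi j hl j.2.le; omega
      · have := hj i hl i.2.le; omega
    · intro h hh
      simp only [Set.mem_Iio] at hh
      have hne : ∃ n, n ≤ k ∧ height a n ≤ h := ⟨0, by omega, by rw [height_zero]; omega⟩
      have hs := Nat.findGreatest_spec (P := fun n => height a n ≤ h) (Nat.zero_le k)
        (by simp only [height_zero]; omega)
      have hle := Nat.findGreatest_le (P := fun n => height a n ≤ h) k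
      have hg : ∀ l, Nat.findGreatest (fun n => height a n ≤ h) k < l → l ≤ k →
          ¬ height a l ≤ h := fun l h1 h2 => Nat.findGreatest_is_greatest h1 h2
      generalize Nat.findGreatest (fun n => height a n ≤ h) k = n at hs hle hg
      have hnk : n < k := by
        rcases hle.lt_or_eq with h' | h'
        · exact h'
        · subst h'; omega
      have h1 := hg (n + 1) (by omega) (by omega)
      have h2 := height_step a hnk
      have hn : height a n = h := by omega
      refine ⟨⟨n, hnk⟩, (white_iff a).2 ?_, by simp [hn]⟩
      intro l hl hlk
      have := hg l hl hlk
      simp only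
      omega
  rw [key, Set.ncard_eq_toFinset_card', Set.toFinset_Iio, Nat.card_Iio]

theorem whitesBefore_lt (p : MotzkinPath k r) {i : Fin k} (hi : White p.1 i) :
    whitesBefore p.1 i < r := by
  classical
  refine lt_of_lt_of_eq ?_ (card_white p)
  rw [whitesBefore, ← Set.ncard_coe_finset]
  refine Set.ncard_lt_ncard ⟨fun j hj => ?_, fun h => ?_⟩ (Set.toFinite _)
  · simp at hj; exact hj.2
  · have := h hi
    simp at this

theorem exists_whitesBefore (p : MotzkinPath k r) {n : ℕ} (hn : n < r) :
    ∃ i, White p.1 i ∧ whitesBefore p.1 i = n := by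
  have himg : whitesBefore p.1 '' {i | White p.1 i} = Set.Iio r := by
    refine Set.eq_of_subset_of_ncard_le ?_ ?_ (Set.finite_Iio r)
    · rintro _ ⟨i, hi, rfl⟩
      exact whitesBefore_lt p hi
    · rw [Set.InjOn.ncard_image fun i hi j hj h => hi.eq_of hj h, card_white,
        Set.ncard_eq_toFinset_card', Set.toFinset_Iio, Nat.card_Iio]
  obtain ⟨i, hi, h⟩ := himg.ge (Set.mem_Iio.2 hn)
  exact ⟨i, hi, h⟩

theorem rank_diagram (p q : MotzkinPath k r) : (diagram p.1 q.1).rank = r := by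
  rw [Diagram.rank]
  refine Eq.trans ?_ (card_white p)
  refine Set.ncard_congr (fun e _ => e.1) (fun e he => he.1) ?_ ?_
  · rintro ⟨i, j⟩ ⟨i', j'⟩ h h' (rfl : i = i')
    obtain rfl : j = j' := h.2.1.eq_of h'.2.1 (h.2.2.symm.trans h'.2.2)
    rfl
  · intro i hi
    obtain ⟨j, hj, h⟩ := exists_whitesBefore q (whitesBefore_lt p hi)
    exact ⟨(i, j), ⟨hi, hj, h.symm⟩, rfl⟩

theorem comp_upper (d₁ d₂ : Diagram k) {i j : Fin k} (h : d₁.graph.Adj (.inl i) (.inl j)) :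
    (comp d₁ d₂).graph.Adj (.inl i) (.inl j) :=
  ⟨h.ne, (stack_adj_upper d₁ d₂ h).reachable⟩

theorem comp_lower (d₁ d₂ : Diagram k) {i j : Fin k} (h : d₂.graph.Adj (.inr i) (.inr j)) :
    (comp d₁ d₂).graph.Adj (.inr i) (.inr j) :=
  ⟨h.ne, (stack_adj_lower d₁ d₂ h).reachable⟩

theorem exists_upper_of_comp (d₁ d₂ : Diagram k) {i : Fin k} {v}
    (h : (comp d₁ d₂).graph.Adj (.inl i) v) : ∃ b, d₁.graph.Adj (.inl i) b :=
  strand_upper d₁ d₂ h.1 h.2 _ (SimpleGraph.Reachable.refl _)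

theorem exists_lower_of_comp (d₁ d₂ : Diagram k) {i : Fin k} {v}
    (h : (comp d₁ d₂).graph.Adj (.inr i) v) : ∃ b, d₂.graph.Adj (.inr i) b :=
  strand_lower d₁ d₂ h.1 h.2 _ (SimpleGraph.Reachable.refl _)

/-- The product diagram either has the expected horizontal and vertical edges, or loses rank. -/
theorem comp_eq_or_rank_lt (p q : MotzkinPath k r) :
    comp (diagram p.1 p.1) (diagram q.1 q.1) = diagram p.1 q.1 ∨
      (comp (diagram p.1 p.1) (diagram q.1 q.1)).rank < r := by
  classical
  by_contra! hcon
  obtain ⟨hne, hrank⟩ := hcon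
  apply hne
  clear hne
  have hup : ∀ {i v}, (comp (diagram p.1 p.1) (diagram q.1 q.1)).graph.Adj (.inl i) v →
      White p.1 i ∨ ∃ j, v = .inl j ∧ Arc p.1 i j := by
    intro i v h
    obtain ⟨b | b, hb⟩ := exists_upper_of_comp _ _ h
    · exact Or.inr ⟨b, Diagram.unique _ _ _ _ h (comp_upper _ _ hb), hb⟩
    · exact Or.inl hb.1
  have hlo : ∀ {i v}, (comp (diagram p.1 p.1) (diagram q.1 q.1)).graph.Adj (.inr i) v →
      White q.1 i ∨ ∃ j, v = .inr j ∧ Arc q.1 i j := by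
    intro i v h
    obtain ⟨b | b, hb⟩ := exists_lower_of_comp _ _ h
    · exact Or.inl hb.2.1
    · exact Or.inr ⟨b, Diagram.unique _ _ _ _ h (comp_lower _ _ hb), hb⟩
  have hcu : ∀ {i j}, Arc p.1 i j →
      (comp (diagram p.1 p.1) (diagram q.1 q.1)).graph.Adj (.inl i) (.inl j) :=
    fun h => comp_upper _ _ h
  have hcl : ∀ {i j}, Arc q.1 i j →
      (comp (diagram p.1 p.1) (diagram q.1 q.1)).graph.Adj (.inr i) (.inr j) :=
    fun h => comp_lower _ _ h
  rw [Diagram.rank] at hrank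
  generalize comp (diagram p.1 p.1) (diagram q.1 q.1) = D at hup hlo hcu hcl hrank
  set E : Set (Fin k × Fin k) := {e | D.graph.Adj (.inl e.1) (.inr e.2)} with hE
  have hE1 : ∀ {i j}, (i, j) ∈ E → White p.1 i := fun {i j} h => by
    rcases hup h with h | ⟨_, h, _⟩
    · exact h
    · cases h
  have hE2 : ∀ {i j}, (i, j) ∈ E → White q.1 j := fun {i j} h => by
    rcases hlo (SimpleGraph.Adj.symm h) with h | ⟨_, h, _⟩
    · exact h
    · cases h
  have inj1 : Set.InjOn Prod.fst E := by
    rintro ⟨i, j⟩ h ⟨i', j'⟩ h' (rfl : i = i')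
    obtain rfl : j = j' := Sum.inr_injective (D.unique _ _ _ h h')
    rfl
  have inj2 : Set.InjOn Prod.snd E := by
    rintro ⟨i, j⟩ h ⟨i', j'⟩ h' (rfl : j = j')
    obtain rfl : i = i' := Sum.inl_injective
      (D.unique _ _ _ (SimpleGraph.Adj.symm h) (SimpleGraph.Adj.symm h'))
    rfl
  have img1 : Prod.fst '' E = {i | White p.1 i} := by
    refine Set.eq_of_subset_of_ncard_le ?_ ?_ (Set.toFinite _)
    · rintro _ ⟨⟨i, j⟩, h, rfl⟩
      exact hE1 h
    · rw [Set.InjOn.ncard_image inj1, card_white]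
      exact hrank
  have img2 : Prod.snd '' E = {i | White q.1 i} := by
    refine Set.eq_of_subset_of_ncard_le ?_ ?_ (Set.toFinite _)
    · rintro _ ⟨⟨i, j⟩, h, rfl⟩
      exact hE2 h
    · rw [Set.InjOn.ncard_image inj2, card_white]
      exact hrank
  have mono : ∀ {i j i' j'}, (i, j) ∈ E → (i', j') ∈ E → (i < i' ↔ j < j') := by
    have aux : ∀ {i j i' j'}, (i, j) ∈ E → (i', j') ∈ E → i < i' → j < j' := by
      intro i j i' j' h h' hi
      have hpl := D.planar _ _ _ _ h h'
      simp only [pos] at hpl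
      have hne : j ≠ j' := by
        rintro rfl
        have := inj2 h h' rfl
        simp only [Prod.mk.injEq, and_true] at this
        exact hi.ne this
      have := hpl (Fin.lt_def.1 hi) (by omega)
      rw [Fin.lt_def]
      have : (j : ℕ) ≠ j' := fun e => hne (Fin.ext e)
      omega
    intro i j i' j' h h'
    refine ⟨aux h h', fun hj => ?_⟩
    rcases lt_trichotomy i i' with hl | rfl | hl
    · exact hl
    · have := inj1 h h' rfl
      simp only [Prod.mk.injEq, true_and] at this
      exact absurd this hj.ne
    · exact absurd (aux h' h hl) hj.not_gt
  have count : ∀ {i j}, (i, j) ∈ E → whitesBefore p.1 i = whitesBefore q.1 j := by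
    intro i j h
    have e1 : whitesBefore p.1 i = Set.ncard (Prod.fst '' {e ∈ E | e.1 < i}) := by
      rw [whitesBefore, ← Set.ncard_coe_finset]
      congr 1
      ext l
      simp only [Finset.coe_filter, Finset.mem_univ, true_and, Set.mem_ofPred_eq, Set.mem_image]
      constructor
      · rintro ⟨hl, hw⟩
        obtain ⟨e, he, rfl⟩ := img1.ge hw
        exact ⟨e, ⟨he, hl⟩, rfl⟩
      · rintro ⟨e, ⟨he, hl⟩, rfl⟩
        exact ⟨hl, hE1 he⟩
    have e2 : whitesBefore q.1 j = Set.ncard (Prod.snd '' {e ∈ E | e.2 < j}) := by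
      rw [whitesBefore, ← Set.ncard_coe_finset]
      congr 1
      ext l
      simp only [Finset.coe_filter, Finset.mem_univ, true_and, Set.mem_ofPred_eq, Set.mem_image]
      constructor
      · rintro ⟨hl, hw⟩
        obtain ⟨e, he, rfl⟩ := img2.ge hw
        exact ⟨e, ⟨he, hl⟩, rfl⟩
      · rintro ⟨e, ⟨he, hl⟩, rfl⟩
        exact ⟨hl, hE2 he⟩
    rw [e1, e2, Set.InjOn.ncard_image (inj1.mono fun _ h => h.1),
      Set.InjOn.ncard_image (inj2.mono fun _ h => h.1)]
    congr 1
    ext e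
    exact and_congr_right fun he => mono he h
  have vert : ∀ {i j}, White p.1 i → White q.1 j → whitesBefore p.1 i = whitesBefore q.1 j →
      (i, j) ∈ E := by
    intro i j hi hj hij
    obtain ⟨⟨i, j'⟩, he, rfl⟩ := img1.ge hi
    obtain rfl := hj.eq_of (hE2 he) (hij.symm.trans (count he))
    exact he
  have covered1 : ∀ {i}, White p.1 i → ∃ j, (i, j) ∈ E := fun hi => by
    obtain ⟨⟨i, j⟩, he, rfl⟩ := img1.ge hi
    exact ⟨j, he⟩
  have covered2 : ∀ {j}, White q.1 j → ∃ i, (i, j) ∈ E := fun hi => by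
    obtain ⟨⟨i, j⟩, he, rfl⟩ := img2.ge hi
    exact ⟨i, he⟩
  ext v w
  rcases v with i | i <;> rcases w with j | j
  · refine ⟨fun h => ?_, fun h => hcu h⟩
    rcases hup h with hw | ⟨j', hj', ha⟩
    · obtain ⟨l, hl⟩ := covered1 hw
      cases D.unique _ _ _ h hl
    · cases hj'; exact ha
  · exact ⟨fun h => ⟨hE1 h, hE2 h, count h⟩, fun h => vert h.1 h.2.1 h.2.2⟩
  · exact ⟨fun h => ⟨hE1 (SimpleGraph.Adj.symm h), hE2 (SimpleGraph.Adj.symm h),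
      count (SimpleGraph.Adj.symm h)⟩, fun h => SimpleGraph.Adj.symm (vert h.1 h.2.1 h.2.2)⟩
  · refine ⟨fun h => ?_, fun h => hcl h⟩
    rcases hlo h with hw | ⟨j', hj', ha⟩
    · obtain ⟨l, hl⟩ := covered2 hw
      cases D.unique _ _ _ h (SimpleGraph.Adj.symm hl)
    · cases hj'; exact ha

variable {K : Type*} [CommRing K]

theorem coeff_eq_zero_of_mem_rankLT {a : MotzkinAlgebra K k} (ha : a ∈ rankLT K k r)
    {d : Diagram k} (hd : r ≤ d.rank) : a d = 0 := by
  induction ha using Submodule.span_induction with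
  | mem a h =>
    obtain ⟨d', h', rfl⟩ := h
    exact Finsupp.single_eq_of_ne (by rintro rfl; omega)
  | zero => rfl
  | add a b _ _ ha hb => rw [Finsupp.add_apply, ha, hb, add_zero]
  | smul c a _ ha => rw [Finsupp.smul_apply, ha, smul_zero]

theorem mul_single (x : K) (d₁ d₂ : Diagram k) :
    mul x (Finsupp.single d₁ 1) (Finsupp.single d₂ 1) =
      Finsupp.single (comp d₁ d₂) (x ^ loops d₁ d₂) := by
  rw [mul]
  have h : ∀ d : Diagram k, Finsupp.single d (1 : K) = Finsupp.basisSingleOne (R := K) d := by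
    simp
  rw [h, h, Module.Basis.constr_basis, Module.Basis.constr_basis]

theorem cellForm_single (x : K) (p q : MotzkinPath k r) :
    cellForm x k r (Finsupp.single p 1) (Finsupp.single q 1) =
      mul x (pathDiagram p p) (pathDiagram q q) (diagram p.1 q.1) := by
  rw [cellForm]
  have h : ∀ d : MotzkinPath k r, Finsupp.single d (1 : K) =
      Finsupp.basisSingleOne (R := K) d := by
    simp
  rw [h, h, Module.Basis.constr_basis, Module.Basis.constr_basis]

/-- The value `⟨p, q⟩` is the unique scalar satisfying the defining congruence. -/
theorem cellForm_iff (x : K) (p q : MotzkinPath k r) (c : K) :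
    mul x (pathDiagram p p) (pathDiagram q q) - c • pathDiagram p q ∈ rankLT K k r ↔
      cellForm x k r (Finsupp.single p 1) (Finsupp.single q 1) = c := by
  rw [cellForm_single]
  constructor
  · intro h
    have := coeff_eq_zero_of_mem_rankLT h (rank_diagram p q).ge
    rw [Finsupp.sub_apply, Finsupp.smul_apply, pathDiagram, pathDiagram, pathDiagram,
      Finsupp.single_eq_same, smul_eq_mul, mul_one] at this
    exact sub_eq_zero.1 this
  · rintro rfl
    simp only [pathDiagram, mul_single]
    rcases comp_eq_or_rank_lt p q with h | h
    · rw [h, Finsupp.single_eq_same, Finsupp.smul_single, smul_eq_mul, mul_one, sub_self]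
      exact Submodule.zero_mem _
    · rw [Finsupp.single_eq_of_ne, zero_smul, sub_zero]
      · rw [← mul_one (x ^ _), ← smul_eq_mul, ← Finsupp.smul_single]
        exact Submodule.smul_mem _ _ (Submodule.subset_span ⟨_, h, rfl⟩)
      · intro e
        rw [← e, rank_diagram] at h
        exact lt_irrefl _ h

theorem gramMatrix_apply (x : K) (p q : MotzkinPath k r) :
    gramMatrix x k r p q = cellForm x k r (Finsupp.single p 1) (Finsupp.single q 1) := by
  rw [gramMatrix, LinearMap.BilinForm.toMatrix_apply, Finsupp.coe_basisSingleOne]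

end WellDefined

end Motzkin

/-! With denominators cleared, both sides are polynomials in the parameter with integer
coefficients, so it is enough to know the determinant at infinitely many integers x = m + 1. Take a
set `Γ` of m + 1 colours and single out one colour `o`. Give the white vertices r distinct labels
different from `o`. A path of rank r then becomes a vector indexed by the colourings of k vertices:
the indicator of those colourings in which paired vertices agree, isolated vertices have colour `o`
and white vertices have their labels (`pathVec_delta`). The inner product of the vectors of p and q
counts the colourings of the middle row of the stacked diagrams that suit both. A closed loop takes
any of the x colours, every other component is forced by its ends, and the forced colours conflict
exactly when the product loses rank. So the count is the Gram entry (`card_colors_eq`).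

The vectors can now be orthogonalised. Split the span of the colours into the line of `o` and an
m-dimensional complement U. Call a function on words of length r harmonic if it lives on letters of
U and is killed by every contraction of neighbouring letters; the indicator of the label word is
harmonic (`delta_mem_harmonic`). Among functions whose slices in the first letter are harmonic of
degree n there are three mutually orthogonal pieces: harmonic functions of degree n + 1, `o`
followed by a harmonic function of degree n, and the image under `ladder` of those of degree n - 1.
They correspond to the steps up, level and down. Building vectors with `ladder` in place of `cup` at
each down-step therefore gives an orthogonal family, and a down-step to height h multiplies the
squared length by u_{h+1}(m)/u_h(m) (`diag_ladder`, `slice_ladder_mem`, `sum_vec_ladder`).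

The difference between `ladder` and `cup` only produces paths whose last step is up or level, so the
two families differ by a unitriangular matrix (`vec_ladder_sub_mem`), and the Gram determinant is
the product of the squared lengths (`det_pathVec`). Induction on k by removing the last step
collects this product into the stated one (`normProd_eq`). For m ≥ 2 no u_n(m) vanishes, which
justifies the divisions. The resulting identity in ℤ[X] is mapped to every commutative ring
(`det_gramMatrix_mul`), and the polynomial P is the determinant of the generic Gram matrix. -/

namespace Motzkin

/-! ### Functions on words: harmonic functions, ladder operators and the standard form -/

section Words

set_option linter.unusedSectionVars false

variable {Γ : Type*} {F : Type*} [Field F]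

/-- The function `d ↦ h (y :: d)`. -/
def slice (y : Γ) : (List Γ → F) →ₗ[F] (List Γ → F) where
  toFun h d := h (y :: d)
  map_add' _ _ := rfl
  map_smul' _ _ := rfl

@[simp] theorem slice_apply (y : Γ) (h : List Γ → F) (d : List Γ) : slice y h d = h (y :: d) := rfl

theorem ext_slice {f g : List Γ → F} (h₀ : f [] = g []) (h : ∀ y, slice y f = slice y g) :
    f = g := by
  funext d
  cases d with
  | nil => exact h₀
  | cons y d => exact congrFun (h y) d

/-- The linear map `O` applied to all letters after the first one. -/
def shift (O : (List Γ → F) →ₗ[F] (List Γ → F)) : (List Γ → F) →ₗ[F] (List Γ → F) where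
  toFun h
    | [] => 0
    | a :: d => O (slice a h) d
  map_add' f g := by
    funext d
    cases d <;> simp
  map_smul' c f := by
    funext d
    cases d <;> simp

@[simp] theorem shift_nil (O : (List Γ → F) →ₗ[F] (List Γ → F)) (h : List Γ → F) :
    shift O h [] = 0 := rfl

@[simp] theorem slice_shift (O : (List Γ → F) →ₗ[F] (List Γ → F)) (h : List Γ → F) (a : Γ) :
    slice a (shift O h) = O (slice a h) := rfl

variable [DecidableEq Γ]

/-- A new first letter, which has to be `o`. -/
def dot (o : Γ) : (List Γ → F) →ₗ[F] (List Γ → F) where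
  toFun h
    | [] => 0
    | a :: d => if a = o then h d else 0
  map_add' f g := by
    funext d
    cases d with
    | nil => simp
    | cons a d => by_cases h : a = o <;> simp [h]
  map_smul' c f := by
    funext d
    cases d with
    | nil => simp
    | cons a d => by_cases h : a = o <;> simp [h]

@[simp] theorem dot_nil (o : Γ) (h : List Γ → F) : dot o h [] = 0 := rfl

theorem slice_dot (o : Γ) (h : List Γ → F) (a : Γ) :
    slice a (dot o h) = if a = o then h else 0 := by
  funext d
  by_cases e : a = o <;> simp [slice, dot, e]

/-- Two new first letters, which have to agree. -/
def cup : (List Γ → F) →ₗ[F] (List Γ → F) where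
  toFun h
    | a :: b :: d => if a = b then h d else 0
    | _ => 0
  map_add' f g := by
    funext d
    rcases d with _ | ⟨a, _ | ⟨b, d⟩⟩
    · simp
    · simp
    · by_cases h : a = b <;> simp [h]
  map_smul' c f := by
    funext d
    rcases d with _ | ⟨a, _ | ⟨b, d⟩⟩
    · simp
    · simp
    · by_cases h : a = b <;> simp [h]

@[simp] theorem cup_nil (h : List Γ → F) : cup h [] = 0 := rfl

@[simp] theorem cup_singleton (h : List Γ → F) (a : Γ) : cup h [a] = 0 := rfl

theorem slice_cup (h : List Γ → F) (a b : Γ) :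
    slice b (slice a (cup h)) = if a = b then h else 0 := by
  funext d
  by_cases e : a = b <;> simp [slice, cup, e]

variable (o : Γ) (u : ℕ → F)

/-- The equivariant embedding of harmonic functions of degree `r` into those of degree `r + 2`
whose slices are harmonic of degree `r + 1`. -/
def ladder : ℕ → (List Γ → F) →ₗ[F] (List Γ → F)
  | 0 => cup - dot o ∘ₗ dot o
  | r + 1 => cup - dot o ∘ₗ dot o - (u r / u (r + 1)) • shift (ladder r)

theorem ladder_nil (r : ℕ) (h : List Γ → F) : ladder o u r h [] = 0 := by
  cases r <;> simp [ladder]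

theorem ladder_singleton (r : ℕ) (h : List Γ → F) (a : Γ) : ladder o u r h [a] = 0 := by
  cases r with
  | zero => simp [ladder, dot]
  | succ r =>
    have : shift (ladder o u r) h [a] = 0 := ladder_nil o u r _
    simp [ladder, dot, this]

theorem slice_slice_cup_sub (h : List Γ → F) (a b : Γ) :
    slice b (slice a ((cup - dot o ∘ₗ dot o : (List Γ → F) →ₗ[F] (List Γ → F)) h)) =
      if a = b ∧ a ≠ o then h else 0 := by
  have e : slice b (slice a ((dot o ∘ₗ dot o : (List Γ → F) →ₗ[F] (List Γ → F)) h)) =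
      if a = o then (if b = o then h else 0) else 0 := by
    rw [LinearMap.comp_apply, slice_dot]
    split_ifs with h1 h2
    · rw [slice_dot, if_pos h2]
    · rw [slice_dot, if_neg h2]
    · rw [map_zero]
  rw [LinearMap.sub_apply, map_sub, map_sub, slice_cup, e]
  by_cases h1 : a = b
  · subst h1
    by_cases h2 : a = o <;> simp [h2]
  · by_cases h2 : a = o
    · subst h2
      simp [h1, Ne.symm h1]
    · simp [h1, h2]

theorem slice_slice_ladder_zero (h : List Γ → F) (a b : Γ) :
    slice b (slice a (ladder o u 0 h)) = if a = b ∧ a ≠ o then h else 0 :=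
  slice_slice_cup_sub o h a b

theorem slice_slice_ladder_succ (r : ℕ) (h : List Γ → F) (a b : Γ) :
    slice b (slice a (ladder o u (r + 1) h)) = (if a = b ∧ a ≠ o then h else 0) -
      (u r / u (r + 1)) • slice b (ladder o u r (slice a h)) := by
  rw [ladder, LinearMap.sub_apply, map_sub, map_sub, slice_slice_cup_sub, LinearMap.smul_apply,
    map_smul, map_smul, slice_shift]

variable [Fintype Γ]

/-- Contraction of the first two letters. -/
def diag : (List Γ → F) →ₗ[F] (List Γ → F) := ∑ z, slice z ∘ₗ slice z

theorem diag_apply (h : List Γ → F) : diag h = ∑ z, slice z (slice z h) := by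
  simp [diag]

/-- Functions supported on words of length `r` which vanish on words containing `o` and which are
killed by all contractions of neighbouring letters. -/
def harmonic : ℕ → Submodule F (List Γ → F)
  | 0 => ⨅ y, LinearMap.ker (slice y)
  | r + 1 => LinearMap.ker (LinearMap.proj (R := F) (φ := fun _ : List Γ => F) []) ⊓
      (⨅ y, (harmonic r).comap (slice y)) ⊓ LinearMap.ker (slice o) ⊓ LinearMap.ker diag

theorem mem_harmonic_zero {h : List Γ → F} : h ∈ harmonic o 0 ↔ ∀ y, slice y h = 0 := by
  simp [harmonic, LinearMap.mem_ker]

theorem mem_harmonic_succ {r : ℕ} {h : List Γ → F} : h ∈ harmonic o (r + 1) ↔ h [] = 0 ∧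
    (∀ y, slice y h ∈ harmonic o r) ∧ slice o h = 0 ∧ diag h = 0 := by
  simp [harmonic, LinearMap.mem_ker, and_assoc]

variable {o u}

theorem diag_eq_zero {r : ℕ} {h : List Γ → F} (hh : h ∈ harmonic o r) : diag h = 0 := by
  cases r with
  | zero =>
    rw [mem_harmonic_zero] at hh
    simp [diag_apply, hh]
  | succ r => exact ((mem_harmonic_succ o).1 hh).2.2.2

theorem slice_o_eq_zero {r : ℕ} {h : List Γ → F} (hh : h ∈ harmonic o r) : slice o h = 0 := by
  cases r with
  | zero => exact (mem_harmonic_zero o).1 hh o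
  | succ r => exact ((mem_harmonic_succ o).1 hh).2.2.1

/-- Subtracting `dot o ∘ₗ dot o` removes the colour `o` from the new pair of letters, and the
correction term starts with a letter of h, which is never `o`. This makes down-steps orthogonal to
level steps. -/
theorem slice_o_ladder {r : ℕ} {h : List Γ → F} (hh : h ∈ harmonic o r) :
    slice o (ladder o u r h) = 0 := by
  refine ext_slice (ladder_singleton o u r h o) fun b => ?_
  cases r with
  | zero => simp [slice_slice_ladder_zero]
  | succ r => simp [slice_slice_ladder_succ, slice_o_eq_zero hh]

theorem sum_ite_slice (f : Γ → List Γ → F) (b : Γ) (hf : f o = 0) :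
    ∑ z, (if z = b ∧ z ≠ o then f z else 0) = f b := by
  rw [Finset.sum_eq_single b]
  · by_cases h : b = o
    · subst h; simp [hf]
    · simp [h]
  · intro z _ hz
    simp [hz]
  · simp

theorem sum_ite_ne (h : List Γ → F) :
    ∑ z, (if z ≠ o then h else 0) = ((Fintype.card Γ : F) - 1) • h := by
  have : ∀ z : Γ, (if z ≠ o then h else 0) = h - if z = o then h else 0 := by
    intro z
    by_cases e : z = o <;> simp [e]
  simp only [this, Finset.sum_sub_distrib, Finset.sum_const, Finset.card_univ,
    Finset.sum_ite_eq', Finset.mem_univ, if_true, sub_smul, one_smul, Nat.cast_smul_eq_nsmul]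

/-- The sequence satisfies the Chebyshev recursion at `card Γ - 1` and has no zeros. -/
structure IsChebyshev (Γ : Type*) [Fintype Γ] (u : ℕ → F) : Prop where
  zero : u 0 = 1
  one : u 1 = (Fintype.card Γ : F) - 1
  add_two : ∀ n, u (n + 2) = ((Fintype.card Γ : F) - 1) * u (n + 1) - u n
  ne_zero : ∀ n, u n ≠ 0

/-- The leading part of `ladder` straightens a zigzag and returns h; the recursive part contracts
the first two letters of h, which gives zero. -/
theorem sum_slice_ladder_slice {r : ℕ} {h : List Γ → F} (hh : h ∈ harmonic o (r + 1)) :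
    ∑ z, slice z (ladder o u r (slice z h)) = h := by
  refine ext_slice ?_ fun b => ?_
  · rw [((mem_harmonic_succ o).1 hh).1, Finset.sum_apply]
    exact Finset.sum_eq_zero fun z _ => ladder_singleton o u r _ z
  · rw [map_sum]
    have key := sum_ite_slice (o := o) (fun z => slice z h) b (slice_o_eq_zero hh)
    cases r with
    | zero =>
      simp only [slice_slice_ladder_zero]
      refine Eq.trans (Finset.sum_congr rfl fun z _ => ?_) key
      by_cases e : z = b <;> simp [e]
    | succ r =>
      simp only [slice_slice_ladder_succ, Finset.sum_sub_distrib, ← Finset.smul_sum, ← map_sum,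
        ← diag_apply, diag_eq_zero hh, map_zero, smul_zero, sub_zero]
      exact key

/-- Closing up the new pair of letters gives a loop in U, worth m = card Γ - 1, minus u_r/u_{r+1}
times a straightened zigzag. The Chebyshev recursion turns m - u_r/u_{r+1} into u_{r+2}/u_{r+1}.
This scalar is the norm ratio of a down-step. -/
theorem diag_ladder (hu : IsChebyshev Γ u) {r : ℕ} {h : List Γ → F} (hh : h ∈ harmonic o r) :
    diag (ladder o u r h) = (u (r + 1) / u r) • h := by
  rw [diag_apply]
  cases r with
  | zero =>
    simp only [slice_slice_ladder_zero, true_and, sum_ite_ne, zero_add, hu.zero, hu.one, div_one]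
  | succ r =>
    simp only [slice_slice_ladder_succ, Finset.sum_sub_distrib, ← Finset.smul_sum, true_and, sum_ite_ne,
      sum_slice_ladder_slice hh]
    rw [← sub_smul, hu.add_two]
    congr 1
    have := hu.ne_zero (r + 1)
    field_simp

/-- The coefficient in `ladder` is chosen for this: contracting the second and third letters gives
`slice y h` from the leading part, and the correction contributes u_r/u_{r+1} times the scalar
u_{r+1}/u_r of `diag_ladder`, so the two cancel. The remaining contractions are handled by
induction. -/
theorem slice_ladder_mem (hu : IsChebyshev Γ u) {r : ℕ} {h : List Γ → F} (hh : h ∈ harmonic o r)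
    (y : Γ) : slice y (ladder o u r h) ∈ harmonic o (r + 1) := by
  induction r generalizing h y with
  | zero =>
    rw [mem_harmonic_succ]
    refine ⟨ladder_singleton o u 0 h y, fun b => ?_, ?_, ?_⟩
    · rw [slice_slice_ladder_zero]
      split_ifs
      · exact hh
      · exact Submodule.zero_mem _
    · rw [slice_slice_ladder_zero, if_neg (by rintro ⟨rfl, h⟩; exact h rfl)]
    · rw [diag_apply]
      refine Finset.sum_eq_zero fun z _ => ?_
      rw [slice_slice_ladder_zero]
      split_ifs
      · exact (mem_harmonic_zero o).1 hh z
      · exact map_zero _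
  | succ r ih =>
    have hs := ((mem_harmonic_succ o).1 hh).2.1
    rw [mem_harmonic_succ]
    refine ⟨ladder_singleton o u (r + 1) h y, fun b => ?_, ?_, ?_⟩
    · rw [slice_slice_ladder_succ]
      refine Submodule.sub_mem _ ?_ (Submodule.smul_mem _ _ (ih (hs y) b))
      split_ifs
      · exact hh
      · exact Submodule.zero_mem _
    · rw [slice_slice_ladder_succ, if_neg (by rintro ⟨rfl, h⟩; exact h rfl),
        slice_o_ladder (hs y), smul_zero, sub_zero]
    · have h1 : ∀ z, slice z (slice z (slice y (ladder o u (r + 1) h))) =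
          (if z = y ∧ z ≠ o then slice z h else 0) -
            (u r / u (r + 1)) • slice z (slice z (ladder o u r (slice y h))) := by
        intro z
        rw [slice_slice_ladder_succ, map_sub, map_smul]
        by_cases e : z = y
        · subst e
          by_cases e' : z = o <;> simp [e']
        · simp [e, Ne.symm e]
      rw [diag_apply]
      simp only [h1, Finset.sum_sub_distrib, ← Finset.smul_sum]
      rw [sum_ite_slice (fun z => slice z h) y (slice_o_eq_zero hh), ← diag_apply,
        diag_ladder hu (hs y), smul_smul, div_mul_div_cancel₀ (hu.ne_zero _),
        div_self (hu.ne_zero _), one_smul, sub_self]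

/-- The standard bilinear form on functions on words of length `r`. -/
def wordForm : ℕ → (List Γ → F) →ₗ[F] (List Γ → F) →ₗ[F] F
  | 0 => (LinearMap.mul F F).compl₁₂ (LinearMap.proj []) (LinearMap.proj [])
  | r + 1 => ∑ y, (wordForm r).compl₁₂ (slice y) (slice y)

@[simp] theorem wordForm_zero (f g : List Γ → F) : wordForm 0 f g = f [] * g [] := by
  simp [wordForm]

theorem wordForm_succ (r : ℕ) (f g : List Γ → F) :
    wordForm (r + 1) f g = ∑ y, wordForm r (slice y f) (slice y g) := by
  simp [wordForm, LinearMap.sum_apply]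

theorem wordForm_comm (r : ℕ) (f g : List Γ → F) : wordForm r f g = wordForm r g f := by
  induction r generalizing f g with
  | zero => simp [mul_comm]
  | succ r ih => simp only [wordForm_succ, ih]

theorem wordForm_dot (r : ℕ) (f g : List Γ → F) :
    wordForm (r + 1) f (dot o g) = wordForm r (slice o f) g := by
  rw [wordForm_succ, Finset.sum_eq_single o]
  · simp [slice_dot]
  · intro y _ hy
    simp [slice_dot, hy]
  · simp

/-- Pairing with the invariant tensor of U is contraction over the colours other than `o`; the
missing summand vanishes because f does not start with `o`. -/
theorem wordForm_cup_sub (r : ℕ) {f : List Γ → F} (g : List Γ → F) (hf : slice o f = 0) :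
    ∑ a, ∑ b, wordForm r (slice b (slice a f)) (if a = b ∧ a ≠ o then g else 0) =
      wordForm r (diag f) g := by
  rw [diag_apply, map_sum, LinearMap.sum_apply]
  refine Finset.sum_congr rfl fun a _ => ?_
  rw [Finset.sum_eq_single a]
  · by_cases h : a = o
    · subst h; simp [hf]
    · simp [h]
  · intro b _ hb
    simp [Ne.symm hb]
  · simp

/-- `ladder` is adjoint to contraction on functions with harmonic slices: by induction the
correction term pairs with a contraction of such a slice, which is zero. -/
theorem wordForm_ladder {r : ℕ} {f : List Γ → F} (g : List Γ → F) (hf : slice o f = 0)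
    (hf' : ∀ y, slice y f ∈ harmonic o (r + 1)) :
    wordForm (r + 2) f (ladder o u r g) = wordForm r (diag f) g := by
  induction r generalizing f g with
  | zero =>
    simp only [wordForm_succ 1, wordForm_succ 0, slice_slice_ladder_zero]
    exact wordForm_cup_sub 0 g hf
  | succ r ih =>
    have h1 : ∀ a, wordForm (r + 2) (slice a f) (ladder o u r (slice a g)) = 0 := by
      intro a
      rw [ih _ (slice_o_eq_zero (hf' a)) ((mem_harmonic_succ o).1 (hf' a)).2.1,
        diag_eq_zero (hf' a), map_zero, LinearMap.zero_apply]
    rw [← wordForm_cup_sub (r + 1) g hf]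
    simp only [wordForm_succ (r + 2), wordForm_succ (r + 1) (slice _ f), slice_slice_ladder_succ,
      map_sub, map_smul, Finset.sum_sub_distrib, ← Finset.smul_sum]
    simp only [← wordForm_succ (r + 1) (slice _ f), h1, Finset.sum_const_zero, smul_zero, sub_zero]

end Words

/-! ### Motzkin paths, their last steps and a total order on them -/

section Paths

variable {k : ℕ}

/-- A sequence of steps with nonnegative heights which ends at height `r`. -/
def IsPath (a : Fin k → SignType) (r : ℕ) : Prop :=
  (∀ n ≤ k, 0 ≤ height a n) ∧ height a k = r

theorem height_init (a : Fin (k + 1) → SignType) {n : ℕ} (hn : n ≤ k) :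
    height (Fin.init a) n = height a n := by
  simp only [height, Fin.sum_univ_castSucc, Fin.val_last, if_neg hn.not_gt, add_zero,
    Fin.val_castSucc]
  rfl

theorem height_last (a : Fin (k + 1) → SignType) :
    height a (k + 1) = height (Fin.init a) k + (a (Fin.last k) : ℤ) := by
  rw [height_init a le_rfl]
  exact height_succ a (Fin.last k)

theorem isPath_iff (a : Fin k → SignType) (r : ℕ) :
    IsPath a r ↔ (∀ s, 0 ≤ ∑ i ∈ Finset.Iic s, (a i : ℤ)) ∧ ∑ i, (a i : ℤ) = r := by
  have h1 : ∀ s : Fin k, ∑ i ∈ Finset.Iic s, (a i : ℤ) = height a (s + 1) := by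
    intro s
    rw [height, ← Finset.sum_filter]
    refine Finset.sum_congr ?_ fun _ _ => rfl
    ext l
    simp only [Finset.mem_filter, Finset.mem_univ, true_and, Finset.mem_Iic, Fin.le_def]
    omega
  have h2 : ∑ i, (a i : ℤ) = height a k :=
    Finset.sum_congr rfl fun i _ => (if_pos i.2).symm
  simp only [h1, h2, IsPath]
  refine and_congr_left fun _ => ⟨fun h s => h _ s.2, fun h n hn => ?_⟩
  cases n with
  | zero => rw [height_zero]
  | succ n => exact h ⟨n, hn⟩

theorem isPath_zero (a : Fin 0 → SignType) (r : ℕ) : IsPath a r ↔ r = 0 := by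
  simp [IsPath, height, eq_comm]

theorem isPath_succ (a : Fin (k + 1) → SignType) (r : ℕ) : IsPath a r ↔
    (∀ n ≤ k, 0 ≤ height (Fin.init a) n) ∧
      height (Fin.init a) k + (a (Fin.last k) : ℤ) = r := by
  rw [IsPath, ← height_last]
  refine and_congr_left fun h => ⟨fun H n hn => ?_, fun H n hn => ?_⟩
  · rw [height_init a hn]
    exact H n (by omega)
  · rcases hn.lt_or_eq with h' | rfl
    · rw [← height_init a (by omega)]
      exact H n (by omega)
    · omega

theorem IsPath.height_toNat {a : Fin k → SignType} {r : ℕ} (h : IsPath a r) :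
    (height a k).toNat = r := by
  simp [h.2]

theorem IsPath.eq {a : Fin k → SignType} {r s : ℕ} (h : IsPath a r) (h' : IsPath a s) : r = s := by
  rw [← h.height_toNat, h'.height_toNat]

theorem IsPath.cases {a : Fin (k + 1) → SignType} {r : ℕ} (h : IsPath a r) :
    (a (Fin.last k) = 1 ∧ ∃ s, r = s + 1 ∧ IsPath (Fin.init a) s) ∨
      (a (Fin.last k) = 0 ∧ IsPath (Fin.init a) r) ∨
      (a (Fin.last k) = -1 ∧ IsPath (Fin.init a) (r + 1)) := by
  obtain ⟨h1, h2⟩ := (isPath_succ a r).1 h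
  have h0 := h1 k le_rfl
  rcases e : a (Fin.last k) with _ | _ | _ <;> rw [e] at h2
  · exact Or.inr (Or.inl ⟨rfl, h1, by simpa using h2⟩)
  · exact Or.inr (Or.inr ⟨rfl, h1, by simp at h2; push_cast; omega⟩)
  · refine Or.inl ⟨rfl, r - 1, ?_, h1, ?_⟩ <;> simp at h2 <;> omega

theorem IsPath.up {a : Fin k → SignType} {r : ℕ} (h : IsPath a r) :
    IsPath (Fin.snoc a 1 : Fin (k + 1) → SignType) (r + 1) := by
  rw [isPath_succ, Fin.init_snoc, Fin.snoc_last]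
  exact ⟨h.1, by simp [h.2]⟩

theorem IsPath.level {a : Fin k → SignType} {r : ℕ} (h : IsPath a r) :
    IsPath (Fin.snoc a 0 : Fin (k + 1) → SignType) r := by
  rw [isPath_succ, Fin.init_snoc, Fin.snoc_last]
  exact ⟨h.1, by simp [h.2]⟩

theorem IsPath.down {a : Fin k → SignType} {r : ℕ} (h : IsPath a (r + 1)) :
    IsPath (Fin.snoc a (-1) : Fin (k + 1) → SignType) r := by
  rw [isPath_succ, Fin.init_snoc, Fin.snoc_last]
  exact ⟨h.1, by simp [h.2]⟩

/-- The position of a path in the reverse lexicographic order with `1 < 0 < -1`. -/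
def code : ∀ k, (Fin k → SignType) → ℕ
  | 0, _ => 0
  | k + 1, a => (match a (Fin.last k) with | .pos => 0 | .zero => 1 | .neg => 2) * 3 ^ k +
      code k (Fin.init a)

/-- The code is a base-three numeral whose leading digit is the last step. Hence the bound `3 ^ k`
in a span of vectors with smaller code imposes no restriction. -/
theorem code_lt (a : Fin k → SignType) : code k a < 3 ^ k := by
  induction k with
  | zero => simp [code]
  | succ k ih =>
    have := ih (Fin.init a)
    rw [code, pow_succ]
    cases a (Fin.last k) <;> simp only <;> omega

theorem code_injective : Function.Injective (code k) := by
  induction k with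
  | zero => exact fun a b _ => Subsingleton.elim _ _
  | succ k ih =>
    intro a b h
    have ha := code_lt (Fin.init a)
    have hb := code_lt (Fin.init b)
    rw [← Fin.snoc_init_self a, ← Fin.snoc_init_self b]
    rw [code, code] at h
    cases ea : a (Fin.last k) <;> cases eb : b (Fin.last k) <;> simp only [ea, eb] at h <;>
      first
      | (exfalso; omega)
      | rw [ih (show code k (Fin.init a) = code k (Fin.init b) by omega)]

end Paths

/-! ### Vectors attached to paths and their orthogonality -/

section Vectors

set_option linter.unusedSectionVars false

variable {Γ : Type*} {F : Type*} [Field F] [DecidableEq Γ] (o : Γ)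

/-- The operator attached to a step, given the operators attached to the down-steps. -/
def stepOp (L : ℕ → (List Γ → F) →ₗ[F] (List Γ → F)) :
    SignType → ℕ → (List Γ → F) →ₗ[F] (List Γ → F)
  | .pos, _ => LinearMap.id
  | .zero, _ => dot o
  | .neg, r => L r

/-- The vector attached to a path and a function of the colours of its white vertices: the steps
are read from right to left. -/
def vec (L : ℕ → (List Γ → F) →ₗ[F] (List Γ → F)) :
    ∀ k, (Fin k → SignType) → (List Γ → F) → (Fin k → Γ) → F
  | 0, _, h, _ => h []
  | k + 1, a, h, c => vec L k (Fin.init a)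
      (slice (c (Fin.last k)) (stepOp o L (a (Fin.last k)) (height a (k + 1)).toNat h)) (Fin.init c)

variable {o} in
theorem sum_snoc {M : Type*} [AddCommMonoid M] [Fintype Γ] {k : ℕ} (G : (Fin (k + 1) → Γ) → M) :
    ∑ c, G c = ∑ y, ∑ c : Fin k → Γ, G (Fin.snoc c y : Fin (k + 1) → Γ) := by
  rw [← Fintype.sum_prod_type', ← (Fin.snocEquiv fun _ : Fin (k + 1) => Γ).sum_comp]
  rfl

/-- The squared norm of the orthogonal basis vector attached to a path. -/
def normSq (u : ℕ → F) : ∀ k, (Fin k → SignType) → F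
  | 0, _ => 1
  | k + 1, a => normSq u k (Fin.init a) * (if a (Fin.last k) = -1 then
      u ((height a (k + 1)).toNat + 1) / u (height a (k + 1)).toNat else 1)

variable {o} {u : ℕ → F} [Fintype Γ]

/-- One step of the orthogonality proof: up, level and down produce mutually orthogonal functions
with slices of degree n, and only the down-step changes the form, by a scalar. -/
theorem wordForm_steps (hu : IsChebyshev Γ u) {r s n : ℕ} {f g : List Γ → F} {e e' : SignType}
    (hf : f ∈ harmonic o r) (hg : g ∈ harmonic o s)
    (h : (e = 1 ∧ r = n + 1) ∨ (e = 0 ∧ r = n) ∨ (e = -1 ∧ r + 1 = n))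
    (h' : (e' = 1 ∧ s = n + 1) ∨ (e' = 0 ∧ s = n) ∨ (e' = -1 ∧ s + 1 = n)) :
    wordForm (n + 1) (stepOp o (ladder o u) e r f) (stepOp o (ladder o u) e' s g) =
      if e = e' then (if e = -1 then u (r + 1) / u r else 1) * wordForm r f g else 0 := by
  -- Up against down: adjointness moves `ladder` to a contraction of a harmonic function.
  have A : ∀ {r : ℕ} {f g : List Γ → F}, f ∈ harmonic o (r + 2) → g ∈ harmonic o r →
      wordForm (r + 2) f (ladder o u r g) = 0 := by
    intro r f g hf hg
    rw [wordForm_ladder g (slice_o_eq_zero hf) ((mem_harmonic_succ o).1 hf).2.1,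
      diag_eq_zero hf, map_zero, LinearMap.zero_apply]
  rcases h with ⟨rfl, rfl⟩ | ⟨rfl, rfl⟩ | ⟨rfl, rfl⟩ <;>
    rcases h' with ⟨rfl, h'⟩ | ⟨rfl, h'⟩ | ⟨rfl, h'⟩
  · subst h'
    have : (1 : SignType) ≠ -1 := by decide
    simp only [this, if_true, if_false, one_mul]
    rfl
  · subst h'
    rw [if_neg (by decide)]
    change wordForm (s + 1) f (dot o g) = 0
    rw [wordForm_dot, slice_o_eq_zero hf, map_zero, LinearMap.zero_apply]
  · subst h'
    rw [if_neg (by decide)]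
    exact A hf hg
  · subst h'
    rw [if_neg (by decide), wordForm_comm]
    change wordForm (r + 1) g (dot o f) = 0
    rw [wordForm_dot, slice_o_eq_zero hg, map_zero, LinearMap.zero_apply]
  · subst h'
    have : (0 : SignType) ≠ -1 := by decide
    simp only [this, if_true, if_false, one_mul]
    refine (wordForm_dot _ _ _).trans ?_
    change wordForm s (slice o (dot o f)) g = _
    rw [slice_dot, if_pos rfl]
  · subst h'
    rw [if_neg (by decide), wordForm_comm]
    exact (wordForm_dot _ _ _).trans (by
      change wordForm (s + 1) (slice o (ladder o u s g)) f = 0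
      rw [slice_o_ladder hg]; simp)
  · subst h'
    rw [if_neg (by decide), wordForm_comm]
    exact A hg hf
  · subst h'
    rw [if_neg (by decide)]
    exact (wordForm_dot _ _ _).trans (by
      change wordForm (r + 1) (slice o (ladder o u r f)) g = 0
      rw [slice_o_ladder hf]; simp)
  -- Down against down: adjointness removes one `ladder` and contraction evaluates the other.
  · obtain rfl : s = r := by omega
    rw [if_pos rfl, if_pos rfl]
    change wordForm (s + 2) (ladder o u s f) (ladder o u s g) = _
    rw [wordForm_ladder g (slice_o_ladder hf) (slice_ladder_mem hu hf), diag_ladder hu hf]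
    simp

theorem slice_step_mem (hu : IsChebyshev Γ u) {r n : ℕ} {f : List Γ → F} {e : SignType}
    (hf : f ∈ harmonic o r) (h : (e = 1 ∧ r = n + 1) ∨ (e = 0 ∧ r = n) ∨ (e = -1 ∧ r + 1 = n))
    (y : Γ) : slice y (stepOp o (ladder o u) e r f) ∈ harmonic o n := by
  rcases h with ⟨rfl, rfl⟩ | ⟨rfl, rfl⟩ | ⟨rfl, rfl⟩
  · exact ((mem_harmonic_succ o).1 hf).2.1 y
  · change slice y (dot o f) ∈ _
    rw [slice_dot]
    split_ifs
    · exact hf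
    · exact Submodule.zero_mem _
  · exact slice_ladder_mem hu hf y

theorem IsPath.cases' {k : ℕ} {a : Fin (k + 1) → SignType} {r : ℕ} (h : IsPath a r) :
    ∃ n, IsPath (Fin.init a) n ∧ ((a (Fin.last k) = 1 ∧ r = n + 1) ∨
      (a (Fin.last k) = 0 ∧ r = n) ∨ (a (Fin.last k) = -1 ∧ r + 1 = n)) := by
  rcases h.cases with ⟨h1, s, h2, h3⟩ | ⟨h1, h2⟩ | ⟨h1, h2⟩
  · exact ⟨s, h3, Or.inl ⟨h1, h2⟩⟩
  · exact ⟨r, h2, Or.inr (Or.inl ⟨h1, rfl⟩)⟩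
  · exact ⟨r + 1, h2, Or.inr (Or.inr ⟨h1, rfl⟩)⟩

/-- The vectors attached to the paths by the ladder operators are orthogonal. -/
theorem sum_vec_ladder (hu : IsChebyshev Γ u) {k r s : ℕ} {p q : Fin k → SignType}
    (hp : IsPath p r) (hq : IsPath q s) {f g : List Γ → F} (hf : f ∈ harmonic o r)
    (hg : g ∈ harmonic o s) :
    ∑ c, vec o (ladder o u) k p f c * vec o (ladder o u) k q g c =
      if p = q then normSq u k p * wordForm r f g else 0 := by
  induction k generalizing r s f g with
  | zero =>
    rw [isPath_zero] at hp hq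
    subst hp hq
    simp [vec, normSq, Subsingleton.elim p q]
  | succ k ih =>
    obtain ⟨n, hp', cp⟩ := hp.cases'
    obtain ⟨m, hq', cq⟩ := hq.cases'
    rw [sum_snoc]
    simp only [vec, Fin.init_snoc, Fin.snoc_last, hp.height_toNat, hq.height_toNat]
    rw [Finset.sum_congr rfl fun y _ =>
      ih hp' hq' (slice_step_mem hu hf cp y) (slice_step_mem hu hg cq y)]
    -- Distinct prefixes are orthogonal by induction. For equal prefixes the sum over the last
    -- colour reassembles the form in degree n + 1, where the last steps are compared.
    by_cases e : Fin.init p = Fin.init q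
    · obtain rfl : n = m := by rw [e] at hp'; exact hp'.eq hq'
      simp only [if_pos e, ← Finset.mul_sum, ← wordForm_succ]
      rw [wordForm_steps hu hf hg cp cq, normSq, hp.height_toNat]
      by_cases e' : p (Fin.last k) = q (Fin.last k)
      · have : p = q := by rw [← Fin.snoc_init_self p, ← Fin.snoc_init_self q, e, e']
        rw [if_pos e', if_pos this, mul_assoc]
      · have : p ≠ q := by rintro rfl; exact e' rfl
        rw [if_neg e', if_neg this, mul_zero]
    · have : p ≠ q := by rintro rfl; exact e rfl
      simp [e, this]

end Vectors

/-! ### Unitriangular passage from path vectors to orthogonal vectors -/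

section Triangular

set_option linter.unusedSectionVars false

variable {Γ : Type*} {F : Type*} [Field F]

/-- Families of functions of the colours of `k` vertices. -/
abbrev Vec (Γ F : Type*) (k : ℕ) := (List Γ → F) → (Fin k → Γ) → F

/-- Precomposition with an operator. -/
def pre (O : (List Γ → F) →ₗ[F] (List Γ → F)) (k : ℕ) : Vec Γ F k →ₗ[F] Vec Γ F k where
  toFun φ h := φ (O h)
  map_add' _ _ := rfl
  map_smul' _ _ := rfl

/-- Addition of a last step with a given operator. -/
def app (O : (List Γ → F) →ₗ[F] (List Γ → F)) (k : ℕ) : Vec Γ F k →ₗ[F] Vec Γ F (k + 1) where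
  toFun φ h c := φ (slice (c (Fin.last k)) (O h)) (Fin.init c)
  map_add' _ _ := rfl
  map_smul' _ _ := rfl

theorem shift_sub (O O' : (List Γ → F) →ₗ[F] (List Γ → F)) :
    shift (O - O') = shift O - shift O' := by
  ext h d
  cases d <;> simp [shift]

theorem shift_smul (c : F) (O : (List Γ → F) →ₗ[F] (List Γ → F)) :
    shift (c • O) = c • shift O := by
  ext h d
  cases d <;> simp [shift]

theorem shift_comp (O O' : (List Γ → F) →ₗ[F] (List Γ → F)) :
    shift (O ∘ₗ O') = shift O ∘ₗ shift O' := by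
  ext h d
  cases d <;> rfl

variable [DecidableEq Γ] (o : Γ)

/-- The new letter stands in front of everything O acts on, so O can act afterwards behind it. For
`cup` there are two new letters, hence two shifts. -/
theorem dot_comp (O : (List Γ → F) →ₗ[F] (List Γ → F)) (h : List Γ → F) :
    dot o (O h) = shift O (dot o h) := by
  refine ext_slice rfl fun y => ?_
  rw [slice_shift, slice_dot, slice_dot]
  split_ifs <;> simp

theorem cup_comp (O : (List Γ → F) →ₗ[F] (List Γ → F)) (h : List Γ → F) :
    cup (O h) = shift (shift O) (cup h) := by
  refine ext_slice rfl fun y => ext_slice rfl fun z => ?_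
  rw [slice_shift, slice_shift, slice_cup, slice_cup]
  split_ifs <;> simp

/-- The vector attached to a path. -/
def pathVec (k : ℕ) (a : Fin k → SignType) : Vec Γ F k := vec o (fun _ => cup) k a

theorem pathVec_up {k : ℕ} {a : Fin (k + 1) → SignType} (h : a (Fin.last k) = 1) :
    pathVec (F := F) o (k + 1) a = app LinearMap.id k (pathVec o k (Fin.init a)) := by
  funext f c
  rw [pathVec, vec, h]
  rfl

theorem pathVec_level {k : ℕ} {a : Fin (k + 1) → SignType} (h : a (Fin.last k) = 0) :
    pathVec (F := F) o (k + 1) a = app (dot o) k (pathVec o k (Fin.init a)) := by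
  funext f c
  rw [pathVec, vec, h]
  rfl

theorem pathVec_down {k : ℕ} {a : Fin (k + 1) → SignType} (h : a (Fin.last k) = -1) :
    pathVec (F := F) o (k + 1) a = app cup k (pathVec o k (Fin.init a)) := by
  funext f c
  rw [pathVec, vec, h]
  rfl

variable (F) in
/-- The span of the vectors of the paths of rank `r` with code less than `N`. -/
def lowerSpan (k r N : ℕ) : Submodule F (Vec Γ F k) :=
  Submodule.span F {φ | ∃ a, IsPath a r ∧ code k a < N ∧ φ = pathVec o k a}

theorem pathVec_mem_lowerSpan {k r N : ℕ} {a : Fin k → SignType} (ha : IsPath a r)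
    (hN : code k a < N) : pathVec o k a ∈ lowerSpan F o k r N :=
  Submodule.subset_span ⟨a, ha, hN, rfl⟩

theorem lowerSpan_mono {k r N M : ℕ} (h : N ≤ M) : lowerSpan F o k r N ≤ lowerSpan F o k r M :=
  Submodule.span_mono fun _ ⟨a, h1, h2, h3⟩ => ⟨a, h1, h2.trans_le h, h3⟩

theorem map_mem_of_mem_lowerSpan {k l r N : ℕ} {S : Submodule F (Vec Γ F l)}
    (T : Vec Γ F k →ₗ[F] Vec Γ F l)
    (h : ∀ a, IsPath a r → code k a < N → T (pathVec o k a) ∈ S) {φ : Vec Γ F k}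
    (hφ : φ ∈ lowerSpan F o k r N) : T φ ∈ S := by
  have : lowerSpan F o k r N ≤ S.comap T := by
    rw [lowerSpan, Submodule.span_le]
    rintro _ ⟨a, h1, h2, rfl⟩
    exact h a h1 h2
  exact this hφ

theorem app_id_mem {k r N : ℕ} {φ : Vec Γ F k} (h : φ ∈ lowerSpan F o k r N) :
    app LinearMap.id k φ ∈ lowerSpan F o (k + 1) (r + 1) N := by
  refine map_mem_of_mem_lowerSpan o _ (fun a ha hN => ?_) h
  have e : app LinearMap.id k (pathVec (F := F) o k a) =
      pathVec o (k + 1) (Fin.snoc a 1 : Fin (k + 1) → SignType) := by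
    rw [pathVec_up o (Fin.snoc_last _ _), Fin.init_snoc]
  rw [e]
  refine pathVec_mem_lowerSpan o ha.up ?_
  rw [code, Fin.snoc_last, Fin.init_snoc]
  simpa using hN

theorem app_dot_mem {k r N : ℕ} {φ : Vec Γ F k} (h : φ ∈ lowerSpan F o k r N) :
    app (dot o) k φ ∈ lowerSpan F o (k + 1) r (3 ^ k + N) := by
  refine map_mem_of_mem_lowerSpan o _ (fun a ha hN => ?_) h
  have e : app (dot o) k (pathVec (F := F) o k a) =
      pathVec o (k + 1) (Fin.snoc a 0 : Fin (k + 1) → SignType) := by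
    rw [pathVec_level o (Fin.snoc_last _ _), Fin.init_snoc]
  rw [e]
  refine pathVec_mem_lowerSpan o ha.level ?_
  rw [code, Fin.snoc_last, Fin.init_snoc]
  simpa using hN

theorem app_cup_pathVec {k : ℕ} (a : Fin k → SignType) : app cup k (pathVec (F := F) o k a) =
    pathVec o (k + 1) (Fin.snoc a (-1) : Fin (k + 1) → SignType) := by
  rw [pathVec_down o (Fin.snoc_last _ _), Fin.init_snoc]

theorem app_cup_mem {k r N : ℕ} {φ : Vec Γ F k} (h : φ ∈ lowerSpan F o k (r + 1) N) :
    app cup k φ ∈ lowerSpan F o (k + 1) r (2 * 3 ^ k + N) := by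
  refine map_mem_of_mem_lowerSpan o _ (fun a ha hN => ?_) h
  rw [app_cup_pathVec]
  refine pathVec_mem_lowerSpan o ha.down ?_
  rw [code, Fin.snoc_last, Fin.init_snoc]
  simpa using hN

/-- The operator and its shifts map vectors of paths of rank `t` to combinations of those of
rank `s`. -/
def Diagrammatic (O : (List Γ → F) →ₗ[F] (List Γ → F)) (s t : ℕ) : Prop :=
  ∀ (k m : ℕ) (a : Fin k → SignType), IsPath a (t + m) →
    pre (shift^[m] O) k (pathVec o k a) ∈ lowerSpan F o k (s + m) (3 ^ k)

variable {o} {O O' : (List Γ → F) →ₗ[F] (List Γ → F)} {r s t : ℕ}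

theorem shift_iterate_sub (m : ℕ) : shift^[m] (O - O') = shift^[m] O - shift^[m] O' := by
  induction m with
  | zero => rfl
  | succ m ih => simp only [Function.iterate_succ', Function.comp_apply, ih, shift_sub]

theorem shift_iterate_smul (c : F) (m : ℕ) : shift^[m] (c • O) = c • shift^[m] O := by
  induction m with
  | zero => rfl
  | succ m ih => simp only [Function.iterate_succ', Function.comp_apply, ih, shift_smul]

theorem shift_iterate_comp (m : ℕ) : shift^[m] (O ∘ₗ O') = shift^[m] O ∘ₗ shift^[m] O' := by
  induction m with
  | zero => rfl
  | succ m ih => simp only [Function.iterate_succ', Function.comp_apply, ih, shift_comp]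

theorem pathVec_sub {k : ℕ} {a : Fin k → SignType} {f : List Γ → F} {g : List Γ → F} :
    pathVec o k a (f - g) = pathVec o k a f - pathVec o k a g := by
  induction k generalizing f g with
  | zero => rfl
  | succ k ih =>
    funext c
    simp only [pathVec, vec, map_sub]
    exact congrFun ih _

theorem pathVec_smul {k : ℕ} {a : Fin k → SignType} (x : F) {f : List Γ → F} :
    pathVec o k a (x • f) = x • pathVec o k a f := by
  induction k generalizing f with
  | zero => rfl
  | succ k ih =>
    funext c
    simp only [pathVec, vec, map_smul]
    exact congrFun ih _

theorem Diagrammatic.sub (h : Diagrammatic o O s t) (h' : Diagrammatic o O' s t) :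
    Diagrammatic o (O - O') s t := by
  intro k m a ha
  have e : pre (shift^[m] (O - O')) k (pathVec o k a) =
      pre (shift^[m] O) k (pathVec o k a) - pre (shift^[m] O') k (pathVec o k a) := by
    rw [shift_iterate_sub]
    funext f
    exact pathVec_sub
  rw [e]
  exact Submodule.sub_mem _ (h k m a ha) (h' k m a ha)

theorem Diagrammatic.smul (c : F) (h : Diagrammatic o O s t) : Diagrammatic o (c • O) s t := by
  intro k m a ha
  have e : pre (shift^[m] (c • O)) k (pathVec o k a) = c • pre (shift^[m] O) k (pathVec o k a) := by
    rw [shift_iterate_smul]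
    funext f
    exact pathVec_smul c
  rw [e]
  exact Submodule.smul_mem _ _ (h k m a ha)

theorem Diagrammatic.comp (h : Diagrammatic o O s t) (h' : Diagrammatic o O' r s) :
    Diagrammatic o (O ∘ₗ O') r t := by
  intro k m a ha
  rw [shift_iterate_comp]
  exact map_mem_of_mem_lowerSpan o (pre (shift^[m] O') k) (fun b hb _ => h' k m b hb) (h k m a ha)

theorem Diagrammatic.shift (h : Diagrammatic o O s t) :
    Diagrammatic o (shift O) (s + 1) (t + 1) := by
  intro k m a ha
  have := h k (m + 1) a (by rwa [Nat.add_right_comm, ← add_assoc] at *)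
  rw [Function.iterate_succ_apply] at this
  rwa [Nat.add_right_comm]

/-- It suffices to treat an unshifted operator meeting a final up-step. Level and down steps let the
operator pass to the prefix by `dot_comp` and `cup_comp`, with one more shift after a down-step,
while an up-step uses up one shift. -/
theorem diagrammatic_of_app (h : ∀ (k : ℕ) (a : Fin k → SignType), IsPath a t →
    app O k (pathVec o k a) ∈ lowerSpan F o (k + 1) s (3 ^ (k + 1))) :
    Diagrammatic o O s (t + 1) := by
  intro k
  induction k with
  | zero =>
    intro m a ha
    rw [isPath_zero] at ha
    omega
  | succ k ih =>
    intro m a ha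
    have h3 : 3 ^ k + 3 ^ k ≤ 3 ^ (k + 1) := by
      rw [pow_succ]
      omega
    have h3' : 2 * 3 ^ k + 3 ^ k ≤ 3 ^ (k + 1) := by
      rw [pow_succ]
      omega
    have h3'' : 3 ^ k ≤ 3 ^ (k + 1) := le_of_add_le_left h3
    rcases ha.cases with ⟨e, n, hn, hb⟩ | ⟨e, hb⟩ | ⟨e, hb⟩
    · rw [pathVec_up o e]
      cases m with
      | zero =>
        obtain rfl : n = t := by omega
        exact h k _ hb
      | succ m =>
        have := app_id_mem o (ih m _ (by convert hb using 1; omega))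
        rw [Function.iterate_succ_apply']
        exact lowerSpan_mono o h3'' this
    · rw [pathVec_level o e]
      have e' : pre (Motzkin.shift^[m] O) (k + 1) (app (dot o) k (pathVec o k (Fin.init a))) =
          app (dot o) k (pre (Motzkin.shift^[m] O) k (pathVec o k (Fin.init a))) := by
        funext f c
        change pathVec o k _ (slice _ (dot o (Motzkin.shift^[m] O f))) _ = _
        rw [dot_comp]
        rfl
      rw [e']
      exact lowerSpan_mono o h3 (app_dot_mem o (ih m _ hb))
    · rw [pathVec_down o e]
      have e' : pre (Motzkin.shift^[m] O) (k + 1) (app cup k (pathVec o k (Fin.init a))) =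
          app cup k (pre (Motzkin.shift^[m + 1] O) k (pathVec o k (Fin.init a))) := by
        funext f c
        change pathVec o k _ (slice _ (cup (Motzkin.shift^[m] O f))) _ = _
        rw [cup_comp, Function.iterate_succ_apply']
        rfl
      rw [e']
      exact lowerSpan_mono o h3' (app_cup_mem o (ih (m + 1) _ hb))

/-- Precomposing with `dot o` turns a final up-step into a level step; with `cup`, as in the next
lemma, into a down-step. -/
theorem diagrammatic_dot : Diagrammatic (F := F) o (dot o) s (s + 1) := by
  refine diagrammatic_of_app fun k a ha => ?_
  have := app_dot_mem o (pathVec_mem_lowerSpan (F := F) o ha (code_lt a))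
  exact lowerSpan_mono o (by rw [pow_succ]; omega) this

theorem diagrammatic_cup : Diagrammatic (F := F) (Γ := Γ) o cup s (s + 2) := by
  refine diagrammatic_of_app fun k a ha => ?_
  have := app_cup_mem o (pathVec_mem_lowerSpan (F := F) o ha (code_lt a))
  exact lowerSpan_mono o (by rw [pow_succ]; omega) this

theorem diagrammatic_ladder (u : ℕ → F) (r : ℕ) : Diagrammatic o (ladder o u r) r (r + 2) := by
  have h := fun r => (diagrammatic_cup (F := F) (o := o) (s := r)).sub
    ((diagrammatic_dot (s := r + 1)).comp diagrammatic_dot)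
  induction r with
  | zero => exact h 0
  | succ r ih => exact (h (r + 1)).sub (ih.shift.smul _)

/-- The `cup` term of `ladder` is the path with a final down-step. The term `dot o ∘ₗ dot o` gives
paths ending in a level step and the shifted term gives paths ending in an up-step. Those have
leading digit at most 1, which is the bound `2 * 3 ^ k`. -/
theorem app_ladder_pathVec (u : ℕ → F) {k r : ℕ} {a : Fin k → SignType} (ha : IsPath a (r + 1)) :
    app (ladder o u r) k (pathVec o k a) -
      pathVec o (k + 1) (Fin.snoc a (-1) : Fin (k + 1) → SignType) ∈
        lowerSpan F o (k + 1) r (2 * 3 ^ k) := by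
  have h1 : app (dot o) k (pre (dot o) k (pathVec o k a)) ∈
      lowerSpan F o (k + 1) r (2 * 3 ^ k) := by
    rw [two_mul]
    exact app_dot_mem o (diagrammatic_dot (s := r) k 0 a ha)
  have e1 : app (dot o ∘ₗ dot o) k (pathVec (F := F) o k a) =
      app (dot o) k (pre (dot o) k (pathVec o k a)) := by
    funext f c
    change pathVec o k _ (slice _ (dot o (dot o f))) _ = _
    rw [dot_comp]
    rfl
  have e0 : app (cup - dot o ∘ₗ dot o) k (pathVec (F := F) o k a) =
      app cup k (pathVec o k a) - app (dot o ∘ₗ dot o) k (pathVec o k a) := by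
    funext f c
    change pathVec o k _ (slice _ ((cup - dot o ∘ₗ dot o : (List Γ → F) →ₗ[F] _) f)) _ = _
    rw [LinearMap.sub_apply, map_sub, pathVec_sub]
    rfl
  cases r with
  | zero =>
    rw [ladder, e0, e1, app_cup_pathVec, sub_sub_cancel_left]
    exact Submodule.neg_mem _ h1
  | succ r =>
    have e2 : app (ladder o u (r + 1)) k (pathVec o k a) =
        app (cup - dot o ∘ₗ dot o) k (pathVec o k a) -
          (u r / u (r + 1)) • app LinearMap.id k (pre (ladder o u r) k (pathVec o k a)) := by
      funext f c
      change pathVec o k _ (slice _ (ladder o u (r + 1) f)) _ = _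
      rw [ladder, LinearMap.sub_apply, map_sub, pathVec_sub, LinearMap.smul_apply, map_smul,
        pathVec_smul]
      rfl
    rw [e2, e0, e1, app_cup_pathVec,
      show ∀ x y z : Vec Γ F (k + 1), x - y - z - x = -(y + z) from fun x y z => by abel]
    refine Submodule.neg_mem _ (Submodule.add_mem _ h1 (Submodule.smul_mem _ _ ?_))
    exact lowerSpan_mono o (by omega) (app_id_mem o (diagrammatic_ladder u r k 0 a ha))

theorem app_ladder_mem (u : ℕ → F) {k r N : ℕ} {φ : Vec Γ F k}
    (h : φ ∈ lowerSpan F o k (r + 1) N) :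
    app (ladder o u r) k φ ∈ lowerSpan F o (k + 1) r (2 * 3 ^ k + N) := by
  refine map_mem_of_mem_lowerSpan o _ (fun a ha hN => ?_) h
  rw [← sub_add_cancel (app (ladder o u r) k _)
    (pathVec o (k + 1) (Fin.snoc a (-1) : Fin (k + 1) → SignType))]
  refine Submodule.add_mem _ (lowerSpan_mono o (by omega) (app_ladder_pathVec u ha)) ?_
  rw [← app_cup_pathVec]
  exact app_cup_mem o (pathVec_mem_lowerSpan o ha hN)

/-- The orthogonal vectors arise from the vectors of paths by a unitriangular transformation. -/
theorem vec_ladder_sub_mem (u : ℕ → F) {k r : ℕ} {a : Fin k → SignType} (ha : IsPath a r) :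
    vec o (ladder o u) k a - pathVec o k a ∈ lowerSpan F o k r (code k a) := by
  induction k generalizing r with
  | zero =>
    have : vec o (ladder o u) 0 a = pathVec o 0 a := rfl
    rw [this, sub_self]
    exact Submodule.zero_mem _
  | succ k ih =>
    rcases ha.cases with ⟨e, n, rfl, hb⟩ | ⟨e, hb⟩ | ⟨e, hb⟩
    · have e' : vec o (ladder o u) (k + 1) a =
          app LinearMap.id k (vec o (ladder o u) k (Fin.init a)) := by
        funext f c
        rw [vec, e]
        rfl
      rw [e', pathVec_up o e, ← map_sub, code, e]
      exact lowerSpan_mono o (by omega) (app_id_mem o (ih hb))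
    · have e' : vec o (ladder o u) (k + 1) a =
          app (dot o) k (vec o (ladder o u) k (Fin.init a)) := by
        funext f c
        rw [vec, e]
        rfl
      rw [e', pathVec_level o e, ← map_sub, code, e]
      exact lowerSpan_mono o (by simp) (app_dot_mem o (ih hb))
    · have e' : vec o (ladder o u) (k + 1) a =
          app (ladder o u r) k (vec o (ladder o u) k (Fin.init a)) := by
        funext f c
        rw [vec, e, ha.height_toNat]
        rfl
      have h1 := app_ladder_pathVec (o := o) u hb
      rw [← app_cup_pathVec] at h1
      rw [e', pathVec_down o e, code, e,
        ← sub_add_sub_cancel _ (app (ladder o u r) k (pathVec o k (Fin.init a))), ← map_sub]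
      exact Submodule.add_mem _ (app_ladder_mem u (ih hb)) (lowerSpan_mono o (by simp) h1)

theorem exists_coeff {k r N : ℕ} {φ : Vec Γ F k} (h : φ ∈ lowerSpan F o k r N) :
    ∃ x : MotzkinPath k r → F, (∀ q, N ≤ code k q.1 → x q = 0) ∧
      φ = ∑ q, x q • pathVec o k q.1 := by
  classical
  induction h using Submodule.span_induction with
  | mem φ h =>
    obtain ⟨a, ha, hN, rfl⟩ := h
    refine ⟨Pi.single ⟨a, (isPath_iff a r).1 ha⟩ 1, fun q hq => ?_, ?_⟩
    · rw [Pi.single_eq_of_ne]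
      rintro rfl
      exact absurd hN hq.not_gt
    · rw [Finset.sum_eq_single ⟨a, (isPath_iff a r).1 ha⟩]
      · simp
      · intro q _ hq
        rw [Pi.single_eq_of_ne hq, zero_smul]
      · simp
  | zero => exact ⟨0, by simp, by simp⟩
  | add φ ψ _ _ h1 h2 =>
    obtain ⟨x, hx, rfl⟩ := h1
    obtain ⟨y, hy, rfl⟩ := h2
    refine ⟨x + y, fun q hq => by simp [hx q hq, hy q hq], ?_⟩
    simp only [Pi.add_apply, add_smul, Finset.sum_add_distrib]
  | smul c φ _ h =>
    obtain ⟨x, hx, rfl⟩ := h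
    refine ⟨c • x, fun q hq => by simp [hx q hq], ?_⟩
    simp only [Pi.smul_apply, smul_assoc, Finset.smul_sum]

theorem det_eq_one {ι : Type*} [Fintype ι] [DecidableEq ι] {f : ι → ℕ}
    (hf : Function.Injective f) (A : Matrix ι ι F) (h1 : ∀ p, A p p = 1)
    (h0 : ∀ p q, f p < f q → A p q = 0) : A.det = 1 := by
  let _ : LinearOrder ι := LinearOrder.lift' f hf
  have := Matrix.det_of_isLowerTriangular A fun p q hpq => h0 p q hpq
  simp only [h1, Finset.prod_const_one] at this
  convert this

/-- The Gram determinant of the vectors of paths. -/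
theorem det_pathVec [Fintype Γ] {u : ℕ → F} (hu : IsChebyshev Γ u) {k r : ℕ} {f : List Γ → F}
    (hf : f ∈ harmonic o r) (hf1 : wordForm r f f = 1) :
    (Matrix.of fun p q : MotzkinPath k r =>
      ∑ c, pathVec o k p.1 f c * pathVec o k q.1 f c).det =
        ∏ p : MotzkinPath k r, normSq u k p.1 := by
  have hp : ∀ p : MotzkinPath k r, IsPath p.1 r := fun p => (isPath_iff p.1 r).2 p.2
  choose x hx hx' using fun p : MotzkinPath k r =>
    exists_coeff (vec_ladder_sub_mem (o := o) u (hp p))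
  -- The coefficient `x p q` vanishes unless q has smaller code than p, so A is unitriangular.
  let A : Matrix (MotzkinPath k r) (MotzkinPath k r) F := 1 + Matrix.of x
  have hA : A.det = 1 := by
    refine det_eq_one (f := fun p : MotzkinPath k r => code k p.1)
      (fun p q h => Subtype.ext (code_injective h)) A (fun p => ?_) fun p q h => ?_
    · simp [A, hx p p le_rfl]
    · have : p ≠ q := by rintro rfl; exact lt_irrefl _ h
      simp [A, hx p q h.le, this]
  let V : Matrix (MotzkinPath k r) (Fin k → Γ) F := Matrix.of fun p c => pathVec o k p.1 f c
  let W : Matrix (MotzkinPath k r) (Fin k → Γ) F :=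
    Matrix.of fun p c => vec o (ladder o u) k p.1 f c
  have hW : W = A * V := by
    rw [Matrix.add_mul, Matrix.one_mul]
    ext p c
    have := congrFun (congrFun (hx' p) f) c
    simp only [Pi.sub_apply, Finset.sum_apply, Pi.smul_apply, smul_eq_mul] at this
    rw [sub_eq_iff_eq_add'] at this
    simp only [Matrix.add_apply, Matrix.mul_apply, W, V, Matrix.of_apply]
    exact this
  have hG : (Matrix.of fun p q : MotzkinPath k r =>
      ∑ c, pathVec o k p.1 f c * pathVec o k q.1 f c) = V * V.transpose := by
    ext p q
    simp [Matrix.mul_apply, V]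
  have hD : W * W.transpose = Matrix.diagonal fun p : MotzkinPath k r => normSq u k p.1 := by
    ext p q
    simp only [Matrix.mul_apply, Matrix.transpose_apply, W, Matrix.of_apply]
    rw [sum_vec_ladder hu (hp p) (hp q) hf hf, hf1, mul_one, Matrix.diagonal_apply]
    simp only [Subtype.ext_iff]
  have : (A * (V * V.transpose) * A.transpose).det = (W * W.transpose).det := by
    rw [hW, Matrix.transpose_mul]
    simp only [Matrix.mul_assoc]
  rw [Matrix.det_mul, Matrix.det_mul, Matrix.det_transpose, hA, one_mul, mul_one, hD,
    Matrix.det_diagonal] at this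
  rw [hG, this]

end Triangular

/-! ### White vertices and arcs in terms of heights -/

section Pairing

variable {k : ℕ} {a : Fin k → SignType}

/-- Heights change by at most one, so a level below the current height has a last visit. -/
theorem exists_height_eq {n : ℕ} (hn : n ≤ k) {l : ℤ} (h0 : 0 ≤ l)
    (hl : l < height a n) : ∃ i : Fin k, (i : ℕ) < n ∧ height a i = l ∧
      ∀ m : ℕ, (i : ℕ) < m → m ≤ n → l < height a m := by
  induction n with
  | zero => rw [height_zero] at hl; omega
  | succ n ih =>
    by_cases h : l < height a n
    · obtain ⟨i, h1, h2, h3⟩ := ih (by omega) h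
      refine ⟨i, by omega, h2, fun m hm hmn => ?_⟩
      rcases hmn.lt_or_eq with h' | rfl
      · exact h3 m hm (by omega)
      · exact hl
    · have := height_step a (n := n) (by omega)
      refine ⟨⟨n, by omega⟩, by simp, ?_, fun m hm hmn => ?_⟩
      · change height a n = l
        omega
      · simp only at hm
        obtain rfl : m = n + 1 := by omega
        exact hl

/-- The white vertices before i are the last visits to the levels below the height of i, one for
each level. Thus labels may be indexed by height, which suits induction on the last step. -/
theorem whitesBefore_eq (ha : ∀ n ≤ k, 0 ≤ height a n) {i : Fin k} (hi : White a i) :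
    whitesBefore a i = (height a i).toNat := by
  classical
  have h0 := ha i i.2.le
  have hi' := (white_iff a).1 hi
  rw [whitesBefore, ← Finset.card_range (height a i).toNat]
  refine Finset.card_bij (fun j _ => (height a j).toNat) ?_ ?_ ?_
  · intro j hj
    simp only [Finset.mem_filter, Finset.mem_univ, true_and] at hj
    have h1 := (white_iff a).1 hj.2 i (Fin.lt_def.1 hj.1) i.2.le
    have h2 := ha j j.2.le
    rw [Finset.mem_range]
    omega
  · intro j hj l hl h
    simp only [Finset.mem_filter, Finset.mem_univ, true_and] at hj hl
    have h1 := (white_iff a).1 hj.2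
    have h2 := (white_iff a).1 hl.2
    have h3 := ha j j.2.le
    have h4 := ha l l.2.le
    apply Fin.ext
    by_contra hne
    rcases Nat.lt_or_gt_of_ne hne with h' | h'
    · have := h1 l h' l.2.le; omega
    · have := h2 j h' j.2.le; omega
  · intro l hl
    rw [Finset.mem_range] at hl
    obtain ⟨j, h1, h2, h3⟩ := exists_height_eq (a := a) i.2.le (l := l) (by omega) (by omega)
    refine ⟨j, ?_, by omega⟩
    simp only [Finset.mem_filter, Finset.mem_univ, true_and, Fin.lt_def]
    refine ⟨h1, (white_iff a).2 fun m hm hmk => ?_⟩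
    rw [h2]
    rcases Nat.lt_or_ge i m with h | h
    · have := hi' m h hmk
      omega
    · exact h3 m hm h

/-- Every nonzero step of a path is white or an endpoint of an arc. -/
theorem white_or_arc (ha : ∀ n ≤ k, 0 ≤ height a n) {i : Fin k} (hi : a i ≠ 0) :
    White a i ∨ ∃ j, Arc a i j := by
  rcases step_cases a i with h | h | h
  · by_cases hw : White a i
    · exact Or.inl hw
    · have : ∃ j, Paired a i j := by
        by_contra hn
        push Not at hn
        exact hw ⟨h.1, hn⟩
      exact Or.inr (this.imp fun j hj => Or.inl hj)
  · exact absurd h.1 hi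
  · obtain ⟨j, h1, h2, h3⟩ := exists_height_eq (a := a) i.2.le (ha (i + 1) i.2) (by omega)
    refine Or.inr ⟨j, Or.inr ((paired_iff a).2 ⟨Fin.lt_def.2 h1, h2.symm, ?_⟩)⟩
    rw [h2]
    exact h3

theorem Paired.ne_zero {i j : Fin k} (h : Paired a i j) : a i ≠ 0 ∧ a j ≠ 0 := by
  rw [h.2.1, h.2.2.1]
  decide

theorem Arc.ne_zero {i j : Fin k} (h : Arc a i j) : a i ≠ 0 := by
  rcases h with h | h
  exacts [h.ne_zero.1, h.ne_zero.2]

theorem White.ne_zero {i : Fin k} (h : White a i) : a i ≠ 0 := by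
  rw [h.1]
  decide

end Pairing

/-! ### Effect of the last step on pairings and white vertices -/

section LastStep

variable {k : ℕ} {a : Fin (k + 1) → SignType}

theorem paired_castSucc {i j : Fin k} :
    Paired a i.castSucc j.castSucc ↔ Paired (Fin.init a) i j := by
  rw [paired_iff, paired_iff]
  simp only [Fin.val_castSucc, Fin.castSucc_lt_castSucc_iff]
  have h1 := height_init a (n := j + 1) (by omega)
  have h2 := height_init a (n := i) (by omega)
  rw [h1, h2]
  refine and_congr_right fun _ => and_congr_right fun _ => ?_
  refine forall_congr' fun l => forall_congr' fun _ => forall_congr' fun hl => ?_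
  rw [height_init a (n := l) (by omega)]

theorem not_paired_last {j : Fin (k + 1)} : ¬ Paired a (Fin.last k) j :=
  fun h => absurd h.1 (Fin.le_last j).not_gt

/-- A final down-step closes an arc at the white vertex of the prefix to whose level the path
returns. -/
theorem paired_castSucc_last {i : Fin k} : Paired a i.castSucc (Fin.last k) ↔
    White (Fin.init a) i ∧ height (Fin.init a) i = height a (k + 1) := by
  rw [paired_iff, white_iff, and_comm (b := height (Fin.init a) i = _)]
  simp only [Fin.val_castSucc, Fin.val_last, Fin.castSucc_lt_last, true_and]
  rw [height_init a (n := i) (by omega), eq_comm]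
  refine and_congr_right fun _ => ?_
  refine forall_congr' fun l => forall_congr' fun _ => forall_congr' fun hl => ?_
  rw [height_init a hl]

theorem white_castSucc {i : Fin k} : White a i.castSucc ↔
    White (Fin.init a) i ∧ height (Fin.init a) i < height a (k + 1) := by
  rw [white_iff, white_iff]
  simp only [Fin.val_castSucc]
  rw [height_init a (n := i) (by omega)]
  constructor
  · intro h
    refine ⟨fun l hl hlk => ?_, h _ (by omega) le_rfl⟩
    rw [height_init a hlk]
    exact h l hl (by omega)
  · rintro ⟨h, h'⟩ l hl hlk
    rcases hlk.lt_or_eq with h1 | rfl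
    · rw [← height_init a (n := l) (by omega)]
      exact h l hl (by omega)
    · exact h'

theorem white_last : White a (Fin.last k) ↔ a (Fin.last k) = 1 :=
  ⟨fun h => h.1, fun h => ⟨h, fun _ => not_paired_last⟩⟩

end LastStep

/-! ### Path vectors as indicators of compatible colourings -/

section Delta

set_option linter.unusedSectionVars false

variable {Γ : Type*} {F : Type*} [Field F] [DecidableEq Γ]

variable (F) in
/-- The indicator function of a word. -/
def delta (w : List Γ) : List Γ → F := fun d => if d = w then 1 else 0

theorem slice_delta_cons (x y : Γ) (w : List Γ) :
    slice y (delta F (x :: w)) = if y = x then delta F w else 0 := by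
  funext d
  by_cases h : y = x <;> simp [slice, delta, h]

theorem slice_delta_nil (y : Γ) : slice y (delta F ([] : List Γ)) = 0 := by
  funext d
  simp [slice, delta]

theorem slice_cup_delta (y : Γ) (w : List Γ) : slice y (cup (delta F w)) = delta F (y :: w) := by
  refine ext_slice (by simp [delta]) fun z => ?_
  rw [slice_cup, slice_delta_cons]
  simp only [eq_comm]

/-- The word of the labels with indices `r - 1, …, 0`. -/
def labels (d : ℕ → Γ) : ℕ → List Γ
  | 0 => []
  | r + 1 => d r :: labels d r

theorem labels_congr {d e : ℕ → Γ} {r : ℕ} (h : ∀ n < r, d n = e n) : labels d r = labels e r := by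
  induction r with
  | zero => rfl
  | succ r ih => rw [labels, labels, h r (by omega), ih fun n hn => h n (by omega)]

/-- A colouring of the vertices of a path: paired vertices have the same colour, isolated vertices
the colour `o`, and white vertices are coloured by their labels. -/
def Compatible {k : ℕ} (o : Γ) (d : ℕ → Γ) (a : Fin k → SignType) (c : Fin k → Γ) : Prop :=
  (∀ i j, Paired a i j → c i = c j) ∧ (∀ i, a i = 0 → c i = o) ∧
    ∀ i, White a i → c i = d (height a i).toNat

variable {o : Γ} {d : ℕ → Γ} {k r : ℕ} {a : Fin (k + 1) → SignType} {c : Fin (k + 1) → Γ}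

/-- A final up-step closes no arc and keeps every white vertex of the prefix white; the new vertex
is white with index r. -/
theorem compatible_up (h : a (Fin.last k) = 1) (hr : height (Fin.init a) k = r) :
    Compatible o d a c ↔ Compatible o d (Fin.init a) (Fin.init c) ∧ c (Fin.last k) = d r := by
  have hh : height a (k + 1) = r + 1 := by rw [height_last, h, hr]; rfl
  have e1 : ∀ i, ¬ Paired a (Fin.castSucc i) (Fin.last k) := by
    intro i hi
    obtain ⟨h1, h2⟩ := paired_castSucc_last.1 hi
    have := (white_iff _).1 h1 k i.2 le_rfl
    omega
  have e2 : ∀ i : Fin k, White a i.castSucc ↔ White (Fin.init a) i := by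
    intro i
    rw [white_castSucc]
    refine and_iff_left_of_imp fun h1 => ?_
    have := (white_iff _).1 h1 k i.2 le_rfl
    omega
  simp only [Compatible, Fin.forall_fin_succ', paired_castSucc, not_paired_last, e1, e2,
    white_last, h, Fin.val_castSucc, Fin.val_last, IsEmpty.forall_iff, implies_true, and_true,
    forall_const, one_ne_zero]
  rw [← height_init a le_rfl, hr, Int.toNat_natCast]
  simp only [and_assoc]
  refine and_congr_right fun _ => and_congr_right fun _ => and_congr_left fun _ => ?_
  refine forall_congr' fun i => ?_
  rw [height_init a i.2.le]
  rfl

theorem compatible_level (h : a (Fin.last k) = 0) (hr : height (Fin.init a) k = r) :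
    Compatible o d a c ↔ Compatible o d (Fin.init a) (Fin.init c) ∧ c (Fin.last k) = o := by
  have hh : height a (k + 1) = r := by rw [height_last, h, hr]; simp
  have e1 : ∀ i, ¬ Paired a (Fin.castSucc i) (Fin.last k) := by
    intro i hi
    exact hi.ne_zero.2 h
  have e2 : ∀ i : Fin k, White a i.castSucc ↔ White (Fin.init a) i := by
    intro i
    rw [white_castSucc]
    refine and_iff_left_of_imp fun h1 => ?_
    have := (white_iff _).1 h1 k i.2 le_rfl
    omega
  have e3 : (0 : SignType) ≠ 1 := by decide
  simp only [Compatible, Fin.forall_fin_succ', paired_castSucc, not_paired_last, e1, e2, e3,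
    white_last, h, Fin.val_castSucc, Fin.val_last, IsEmpty.forall_iff, implies_true, and_true,
    forall_const]
  have e4 : (∀ i : Fin k, White (Fin.init a) i → c i.castSucc = d (height a i).toNat) ↔
      ∀ i : Fin k, White (Fin.init a) i → Fin.init c i = d (height (Fin.init a) i).toNat := by
    refine forall_congr' fun i => ?_
    rw [height_init a i.2.le]
    rfl
  rw [e4]
  exact ⟨fun ⟨h1, ⟨h2, h3⟩, h4⟩ => ⟨⟨h1, h2, h4⟩, h3⟩, fun ⟨⟨h1, h2, h4⟩, h3⟩ => ⟨h1, ⟨h2, h3⟩, h4⟩⟩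

/-- The last vertex is paired with the white vertex of index r of the prefix. That vertex has no
prescribed label any more but must share the colour of the last one, which is expressed by updating
the label r. -/
theorem compatible_down (h : a (Fin.last k) = -1) (ha : ∀ n ≤ k, 0 ≤ height (Fin.init a) n)
    (hr : height (Fin.init a) k = r + 1) :
    Compatible o d a c ↔ Compatible o (Function.update d r (c (Fin.last k)))
      (Fin.init a) (Fin.init c) := by
  have hh : height a (k + 1) = r := by rw [height_last, h, hr]; simp
  have e0 : (-1 : SignType) ≠ 0 := by decide
  have e1 : (-1 : SignType) ≠ 1 := by decide
  simp only [Compatible, Fin.forall_fin_succ', paired_castSucc, not_paired_last,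
    paired_castSucc_last, white_castSucc, hh, e0, e1,
    white_last, h, Fin.val_castSucc, Fin.val_last, IsEmpty.forall_iff, implies_true, and_true]
  rw [forall_and]
  constructor
  · rintro ⟨⟨h1, h3⟩, h2, h4⟩
    refine ⟨h1, h2, fun i hi => ?_⟩
    have h5 := (white_iff _).1 hi k i.2 le_rfl
    have h6 := ha i i.2.le
    rcases eq_or_ne (height (Fin.init a) i) r with h7 | h7
    · rw [h7, Int.toNat_natCast, Function.update_self]
      exact h3 i ⟨hi, h7⟩
    · rw [Function.update_of_ne (by omega), height_init a i.2.le]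
      exact h4 i ⟨hi, by omega⟩
  · rintro ⟨h1, h2, h3⟩
    refine ⟨⟨h1, fun i hi => ?_⟩, h2, fun i hi => ?_⟩
    · have := h3 i hi.1
      rwa [hi.2, Int.toNat_natCast, Function.update_self] at this
    · have := h3 i hi.1
      have h6 := ha i i.2.le
      rwa [Function.update_of_ne (by omega), height_init a i.2.le] at this

open Classical in
/-- The vector of a path counts compatible colourings. -/
theorem pathVec_delta {k r : ℕ} {a : Fin k → SignType} (ha : IsPath a r) (d : ℕ → Γ)
    (c : Fin k → Γ) :
    pathVec o k a (delta F (labels d r)) c = if Compatible o d a c then 1 else 0 := by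
  induction k generalizing r d with
  | zero =>
    rw [isPath_zero] at ha
    subst ha
    rw [if_pos ⟨fun i => i.elim0, fun i => i.elim0, fun i => i.elim0⟩]
    simp [pathVec, vec, delta, labels]
  | succ k ih =>
    have hzero : ∀ b : Fin k → SignType, pathVec (F := F) o k b 0 (Fin.init c) = 0 := by
      intro b
      have := congrFun (pathVec_smul (o := o) (a := b) (0 : F) (f := 0)) (Fin.init c)
      simpa using this
    rcases ha.cases with ⟨e, n, rfl, hb⟩ | ⟨e, hb⟩ | ⟨e, hb⟩
    · rw [pathVec_up o e, compatible_up e hb.2]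
      change pathVec o k _ (slice _ (delta F (labels d (n + 1)))) _ = _
      rw [labels, slice_delta_cons]
      by_cases h : c (Fin.last k) = d n
      · simp only [h, if_true, and_true]
        exact ih hb d _
      · simp only [h, if_false, and_false]
        exact hzero _
    · rw [pathVec_level o e, compatible_level e hb.2]
      change pathVec o k _ (slice _ (dot o (delta F (labels d r)))) _ = _
      rw [slice_dot]
      by_cases h : c (Fin.last k) = o
      · simp only [h, if_true, and_true]
        exact ih hb d _
      · simp only [h, if_false, and_false]
        exact hzero _
    · rw [pathVec_down o e, compatible_down e hb.1 (by simpa using hb.2)]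
      change pathVec o k _ (slice _ (cup (delta F (labels d r)))) _ = _
      rw [slice_cup_delta]
      -- The letter added by `cup` is the updated label r; the labels of smaller index are
      -- unchanged.
      have : c (Fin.last k) :: labels d r =
          labels (Function.update d r (c (Fin.last k))) (r + 1) := by
        rw [labels, Function.update_self]
        congr 1
        exact labels_congr fun n hn => (Function.update_of_ne (by omega) _ _).symm
      rw [this]
      exact ih hb _ _

variable [Fintype Γ]

/-- Neighbouring letters of the label word differ, so every contraction vanishes, and no letter is
`o`. -/
theorem delta_mem_harmonic {r : ℕ} (hd : Set.InjOn d (Set.Iio r)) (ho : ∀ n < r, d n ≠ o) :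
    delta F (labels d r) ∈ harmonic o r := by
  induction r with
  | zero => exact (mem_harmonic_zero o).2 slice_delta_nil
  | succ r ih =>
    have ih := ih (hd.mono (Set.Iio_subset_Iio (by omega))) fun n hn => ho n (by omega)
    rw [labels, mem_harmonic_succ]
    refine ⟨by simp [delta], fun y => ?_, ?_, ?_⟩
    · rw [slice_delta_cons]
      split_ifs
      · exact ih
      · exact Submodule.zero_mem _
    · rw [slice_delta_cons, if_neg (ho r (by omega)).symm]
    · rw [diag_apply]
      refine Finset.sum_eq_zero fun z _ => ?_
      rw [slice_delta_cons]
      split_ifs with h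
      · cases r with
        | zero => exact slice_delta_nil _
        | succ r =>
          rw [labels, slice_delta_cons, if_neg]
          intro h'
          have := hd (Set.mem_Iio.2 (by omega)) (Set.mem_Iio.2 (by omega)) (h.symm.trans h')
          omega
      · exact map_zero _

theorem wordForm_delta (r : ℕ) :
    wordForm r (delta F (labels d r)) (delta F (labels d r)) = 1 := by
  induction r with
  | zero => simp [delta, labels]
  | succ r ih =>
    rw [wordForm_succ, Finset.sum_eq_single (d r)]
    · rw [labels, slice_delta_cons, if_pos rfl, ih]
    · intro y _ hy
      rw [labels, slice_delta_cons, if_neg hy, map_zero]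
    · simp

end Delta

/-- The number of functions with prescribed values on the classes of some elements. -/
theorem card_extensions {V Q Γ : Type*} [Finite Q] (f : V → Q) (B : Set V) (g : V → Γ)
    (h : ∃ κ : Q → Γ, ∀ v ∈ B, κ (f v) = g v) :
    Nat.card {κ : Q → Γ // ∀ v ∈ B, κ (f v) = g v} =
      Nat.card Γ ^ Set.ncard {x : Q | ∀ v, f v = x → v ∉ B} := by
  classical
  obtain ⟨κ₀, h₀⟩ := h
  rw [← Nat.card_coe_set_eq, ← Nat.card_fun]
  refine Nat.card_congr ⟨fun κ x => κ.1 x, fun η => ⟨fun x =>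
    if hx : ∀ v, f v = x → v ∉ B then η ⟨x, hx⟩ else κ₀ x, fun v hv => ?_⟩, fun κ => ?_, fun η => ?_⟩
  · have : ¬ ∀ w, f w = f v → w ∉ B := fun H => H v rfl hv
    exact (dif_neg this).trans (h₀ v hv)
  · refine Subtype.ext (funext fun x => ?_)
    by_cases hx : ∀ v, f v = x → v ∉ B
    · simp only [dif_pos hx]
    · simp only [dif_neg hx]
      push Not at hx
      obtain ⟨v, rfl, hv⟩ := hx
      rw [h₀ v hv, κ.2 v hv]
  · funext x
    exact dif_pos x.2

/-! ### Gram entries as numbers of colourings -/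

section Colorings

variable {Γ : Type*} (o : Γ) (d : ℕ → Γ) {k r : ℕ} (p q : MotzkinPath k r)

/-- The vertices of the concatenation whose colour is determined by their row or by one of the two
diagrams. -/
def boundary : Set (Rows k) :=
  {v | ¬ ∃ i : Fin k, v = .inr (.inl i) ∧ (∃ b, (diagram p.1 p.1).graph.Adj (.inr i) b) ∧
    ∃ b, (diagram q.1 q.1).graph.Adj (.inl i) b}

open Classical in
/-- The colours of the boundary vertices. -/
noncomputable def boundaryColor : Rows k → Γ
  | .inl i => if White p.1 i then d (whitesBefore p.1 i) else o
  | .inr (.inl _) => o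
  | .inr (.inr i) => if White q.1 i then d (whitesBefore q.1 i) else o

/-- The product of the two diagrams as a graph. -/
abbrev pathStack : SimpleGraph (Rows k) := stack (diagram p.1 p.1) (diagram q.1 q.1)

variable {p q}

theorem top_mem_boundary (i : Fin k) : .inl i ∈ boundary p q := by
  rintro ⟨j, h, -⟩
  cases h

theorem bot_mem_boundary (i : Fin k) : .inr (.inr i) ∈ boundary p q := by
  rintro ⟨j, h, -⟩
  cases h

theorem exists_adj_inr_iff (i : Fin k) :
    (∃ b, (diagram p.1 p.1).graph.Adj (.inr i) b) ↔ p.1 i ≠ 0 := by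
  constructor
  · rintro ⟨b | b, hb⟩
    · exact White.ne_zero hb.2.1
    · exact Arc.ne_zero hb
  · intro h
    rcases white_or_arc ((isPath_iff p.1 r).2 p.2).1 h with hw | ⟨j, hj⟩
    · exact ⟨.inl i, hw, hw, rfl⟩
    · exact ⟨.inr j, hj⟩

theorem exists_adj_inl_iff (i : Fin k) :
    (∃ b, (diagram p.1 p.1).graph.Adj (.inl i) b) ↔ p.1 i ≠ 0 := by
  constructor
  · rintro ⟨b | b, hb⟩
    · exact Arc.ne_zero hb
    · exact White.ne_zero hb.1
  · intro h
    rcases white_or_arc ((isPath_iff p.1 r).2 p.2).1 h with hw | ⟨j, hj⟩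
    · exact ⟨.inr i, hw, hw, rfl⟩
    · exact ⟨.inl j, hj⟩

theorem mid_mem_boundary (i : Fin k) :
    .inr (.inl i) ∈ boundary p q ↔ p.1 i = 0 ∨ q.1 i = 0 := by
  have : (∃ j : Fin k, (.inr (.inl i) : Rows k) = .inr (.inl j) ∧
      (∃ b, (diagram p.1 p.1).graph.Adj (.inr j) b) ∧
        ∃ b, (diagram q.1 q.1).graph.Adj (.inl j) b) ↔ p.1 i ≠ 0 ∧ q.1 i ≠ 0 := by
    constructor
    · rintro ⟨j, h, h1, h2⟩
      cases h
      exact ⟨(exists_adj_inr_iff i).1 h1, (exists_adj_inl_iff i).1 h2⟩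
    · rintro ⟨h1, h2⟩
      exact ⟨i, rfl, (exists_adj_inr_iff i).2 h1, (exists_adj_inl_iff i).2 h2⟩
  rw [boundary, Set.mem_ofPred_eq, this]
  tauto

theorem isEnd_of_mem_boundary {v : Rows k} (hv : v ∈ boundary p q) :
    IsEnd (diagram p.1 p.1) (diagram q.1 q.1) v := by
  rcases v with i | i | i
  · exact isEnd_outer _ _ (.inl i)
  · rcases (mid_mem_boundary i).1 hv with h | h
    · exact isEnd_mid_of_not_upper _ _ i (by rw [exists_adj_inr_iff]; simpa using h)
    · exact isEnd_mid_of_not_lower _ _ i (by rw [exists_adj_inl_iff]; simpa using h)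
  · exact isEnd_outer _ _ (.inr i)

/-- A colouring of the middle row with the same colours at the ends of arcs, with the colour `o`
at isolated vertices and with the colours of their labels at white vertices. -/
def Colors (o : Γ) (d : ℕ → Γ) (a : Fin k → SignType) (c : Fin k → Γ) : Prop :=
  (∀ i j, Arc a i j → c i = c j) ∧ (∀ i, a i = 0 → c i = o) ∧
    ∀ i, White a i → c i = d (whitesBefore a i)

theorem compatible_iff_colors {a : Fin k → SignType} (ha : IsPath a r) (c : Fin k → Γ) :
    Compatible o d a c ↔ Colors o d a c := by
  refine and_congr ⟨fun h i j hij => ?_, fun h i j hij => h i j (Or.inl hij)⟩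
    (and_congr_right fun _ => forall_congr' fun i => forall_congr' fun hi => ?_)
  · rcases hij with hij | hij
    exacts [h i j hij, (h j i hij).symm]
  · rw [whitesBefore_eq ha.1 hi]

variable (p q)

/-- Extended by the prescribed colours of the outer rows, a colouring of the middle row is constant
along edges, hence a function on components. Isolated middle vertices lie in the boundary, and white
ones are joined to an outer vertex carrying their label. -/
theorem card_colors : Nat.card {c : Fin k → Γ // Colors o d p.1 c ∧ Colors o d q.1 c} =
    Nat.card {κ : (pathStack p q).ConnectedComponent → Γ //
      ∀ v ∈ boundary p q, κ ((pathStack p q).connectedComponentMk v) =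
        boundaryColor o d p q v} := by
  classical
  let ext : (Fin k → Γ) → Rows k → Γ := fun c v => match v with
    | .inl i => boundaryColor o d p q (.inl i)
    | .inr (.inl i) => c i
    | .inr (.inr i) => boundaryColor o d p q (.inr (.inr i))
  have hext : ∀ c, Colors o d p.1 c → Colors o d q.1 c → ∀ v w, (pathStack p q).Adj v w →
      ext c v = ext c w := by
    rintro c ⟨p1, p2, p3⟩ ⟨q1, q2, q3⟩ v w h
    rw [stack_adj] at h
    rcases h with ⟨a, b, h, rfl, rfl⟩ | ⟨a, b, h, rfl, rfl⟩ <;>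
      rcases a with a | a <;> rcases b with b | b <;>
      simp only [ext, upper, lower, boundaryColor]
    · rw [if_neg fun hw => White.not_arc hw h, if_neg fun hw => White.not_arc hw (Arc.symm h)]
    · rw [if_pos h.1, h.2.2, p3 b h.2.1]
    · rw [if_pos h.1, h.2.2, p3 a h.2.1]
    · exact p1 a b h
    · exact q1 a b h
    · rw [if_pos h.2.1, ← h.2.2, q3 a h.1]
    · rw [if_pos h.2.1, ← h.2.2, q3 b h.1]
    · rw [if_neg fun hw => White.not_arc hw h, if_neg fun hw => White.not_arc hw (Arc.symm h)]
  have hadj : ∀ κ : (pathStack p q).ConnectedComponent → Γ, ∀ v w, (pathStack p q).Adj v w →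
      κ ((pathStack p q).connectedComponentMk v) = κ ((pathStack p q).connectedComponentMk w) :=
    fun κ v w h => congrArg κ (SimpleGraph.ConnectedComponent.eq.2 h.reachable)
  refine Nat.card_congr
    { toFun := fun c => ⟨SimpleGraph.ConnectedComponent.lift (ext c.1) fun v w P hP => ?_, ?_⟩
      invFun := fun κ => ⟨fun i => κ.1 ((pathStack p q).connectedComponentMk (.inr (.inl i))),
        ⟨?_, ?_, ?_⟩, ?_, ?_, ?_⟩
      left_inv := fun c => ?_
      right_inv := fun κ => ?_ }
  · clear hP
    induction P with
    | nil => rfl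
    | cons h _ ih => exact (hext _ c.2.1 c.2.2 _ _ h).trans ih
  · rintro (i | i | i) hv
    · rfl
    · rcases (mid_mem_boundary i).1 hv with h | h
      exacts [c.2.1.2.1 i h, c.2.2.2.1 i h]
    · rfl
  · exact fun i j h => hadj κ.1 _ _ (stack_adj_upper (diagram p.1 p.1) (diagram q.1 q.1)
      (v := .inr i) (w := .inr j) h)
  · exact fun i h => κ.2 _ ((mid_mem_boundary i).2 (Or.inl h))
  -- The vertical edge at a white vertex joins it to its copy in the top row, whose colour is
  -- prescribed.
  · intro i h
    refine (hadj κ.1 _ _ (stack_adj_upper (diagram p.1 p.1) (diagram q.1 q.1)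
      (v := .inr i) (w := .inl i) ⟨h, h, rfl⟩)).trans ?_
    exact (κ.2 _ (top_mem_boundary i)).trans (if_pos h)
  · exact fun i j h => hadj κ.1 _ _ (stack_adj_lower (diagram p.1 p.1) (diagram q.1 q.1)
      (v := .inl i) (w := .inl j) h)
  · exact fun i h => κ.2 _ ((mid_mem_boundary i).2 (Or.inr h))
  · intro i h
    refine (hadj κ.1 _ _ (stack_adj_lower (diagram p.1 p.1) (diagram q.1 q.1)
      (v := .inl i) (w := .inr i) ⟨h, h, rfl⟩)).trans ?_
    exact (κ.2 _ (bot_mem_boundary i)).trans (if_pos h)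
  · rfl
  · refine Subtype.ext (funext fun x => ?_)
    induction x using SimpleGraph.ConnectedComponent.ind with
    | h v =>
      rcases v with i | i | i
      · exact (κ.2 _ (top_mem_boundary i)).symm
      · rfl
      · exact (κ.2 _ (bot_mem_boundary i)).symm

variable {d} {o}

/-- If the product of the diagrams has full rank, then the colours of the boundary vertices are
constant on connected components. -/
theorem exists_coloring (h : comp (diagram p.1 p.1) (diagram q.1 q.1) = diagram p.1 q.1) :
    ∃ κ : (pathStack p q).ConnectedComponent → Γ, ∀ v ∈ boundary p q,
      κ ((pathStack p q).connectedComponentMk v) = boundaryColor o d p q v := by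
  classical
  have hadj : ∀ {i j}, White p.1 i → White q.1 j → whitesBefore p.1 i = whitesBefore q.1 j →
      (pathStack p q).Reachable (.inl i) (.inr (.inr j)) := by
    intro i j hi hj hij
    have : (comp (diagram p.1 p.1) (diagram q.1 q.1)).graph.Adj (.inl i) (.inr j) := by
      rw [h]
      exact ⟨hi, hj, hij⟩
    exact this.2
  have huniq : ∀ {u v w}, u ∈ boundary p q → v ∈ boundary p q → w ∈ boundary p q → u ≠ v → u ≠ w →
      (pathStack p q).Reachable u v → (pathStack p q).Reachable u w → v = w :=
    fun hu hv hw => end_unique _ _ (isEnd_of_mem_boundary hu) (isEnd_of_mem_boundary hv)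
      (isEnd_of_mem_boundary hw)
  -- The strand from a white top vertex reaches the white bottom vertex of the same index. A
  -- component has at most two ends, so it contains no further boundary vertex.
  have htop : ∀ i, White p.1 i → ∀ w ∈ boundary p q, (pathStack p q).Reachable (.inl i) w →
      boundaryColor o d p q w = d (whitesBefore p.1 i) := by
    intro i hi w hw hr
    obtain ⟨j, hj, hij⟩ := exists_whitesBefore q (whitesBefore_lt p hi)
    by_cases e : .inl i = w
    · subst e
      exact if_pos hi
    · obtain rfl := huniq (top_mem_boundary i) (bot_mem_boundary j) hw (by simp) e
        (hadj hi hj hij.symm) hr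
      exact (if_pos hj).trans (by rw [hij])
  have hbot : ∀ j, White q.1 j → ∀ w ∈ boundary p q, (pathStack p q).Reachable (.inr (.inr j)) w →
      boundaryColor o d p q w = d (whitesBefore q.1 j) := by
    intro j hj w hw hr
    obtain ⟨i, hi, hij⟩ := exists_whitesBefore p (whitesBefore_lt q hj)
    rw [← hij]
    exact htop i hi w hw ((hadj hi hj hij).trans hr)
  -- All boundary vertices except the white outer ones are coloured `o`, so components without a
  -- white outer vertex cause no conflict.
  have hcases : ∀ v ∈ boundary p q, (∀ w ∈ boundary p q, (pathStack p q).Reachable v w →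
      boundaryColor o d p q w = boundaryColor o d p q v) ∨ boundaryColor o d p q v = o := by
    rintro (i | i | i) hv
    · by_cases hi : White p.1 i
      · refine Or.inl fun w hw hr => ?_
        rw [htop i hi w hw hr]
        exact (if_pos hi).symm
      · exact Or.inr (if_neg hi)
    · exact Or.inr rfl
    · by_cases hi : White q.1 i
      · refine Or.inl fun w hw hr => ?_
        rw [hbot i hi w hw hr]
        exact (if_pos hi).symm
      · exact Or.inr (if_neg hi)
  have hconst : ∀ v ∈ boundary p q, ∀ w ∈ boundary p q, (pathStack p q).Reachable v w →
      boundaryColor o d p q v = boundaryColor o d p q w := by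
    intro v hv w hw hr
    rcases hcases v hv with h1 | h1
    · exact (h1 w hw hr).symm
    · rcases hcases w hw with h2 | h2
      · exact h2 v hv hr.symm
      · rw [h1, h2]
  refine ⟨fun x => if hx : ∃ v ∈ boundary p q, (pathStack p q).connectedComponentMk v = x then
    boundaryColor o d p q hx.choose else o, fun v hv => ?_⟩
  have hx : ∃ w ∈ boundary p q, (pathStack p q).connectedComponentMk w =
    (pathStack p q).connectedComponentMk v := ⟨v, hv, rfl⟩
  simp only [dif_pos hx]
  exact hconst _ hx.choose_spec.1 _ hv (SimpleGraph.ConnectedComponent.eq.1 hx.choose_spec.2)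

/-- If the colours of the boundary vertices are constant on connected components, then the product
of the diagrams has full rank. -/
theorem comp_eq_of_coloring (hd : Set.InjOn d (Set.Iio r)) (ho : ∀ n < r, d n ≠ o)
    (h : ∃ κ : (pathStack p q).ConnectedComponent → Γ, ∀ v ∈ boundary p q,
      κ ((pathStack p q).connectedComponentMk v) = boundaryColor o d p q v) :
    comp (diagram p.1 p.1) (diagram q.1 q.1) = diagram p.1 q.1 := by
  classical
  obtain ⟨κ, hκ⟩ := h
  have hconst : ∀ v ∈ boundary p q, ∀ w ∈ boundary p q, (pathStack p q).Reachable v w →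
      boundaryColor o d p q v = boundaryColor o d p q w := by
    intro v hv w hw hr
    rw [← hκ v hv, ← hκ w hw, SimpleGraph.ConnectedComponent.eq.2 hr]
  -- Parity: a component meets an even number of non-isolated vertices of each diagram. The
  -- component of a white top vertex has one such vertex in the top row and equally many, for the
  -- two diagrams, in the middle row, so it has an odd number in the bottom row.
  have hex : ∀ i, White p.1 i →
      ∃ j, (comp (diagram p.1 p.1) (diagram q.1 q.1)).graph.Adj (.inl i) (.inr j) := by
    intro i hi
    let α : Fin k ⊕ Fin k → ZMod 2 := fun v =>
      if (pathStack p q).Reachable (.inl i) (upper v) ∧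
        ∃ b, (diagram p.1 p.1).graph.Adj v b then 1 else 0
    let β : Fin k ⊕ Fin k → ZMod 2 := fun v =>
      if (pathStack p q).Reachable (.inl i) (lower v) ∧
        ∃ b, (diagram q.1 q.1).graph.Adj v b then 1 else 0
    have hα := total_eq_zero (diagram p.1 p.1) α
      (fun v hv => by
        by_contra hn
        exact hv (if_neg fun h => hn h.2))
      (fun v w hvw => by
        have e1 := (stack_adj_upper (diagram p.1 p.1) (diagram q.1 q.1) hvw).reachable
        have : ((pathStack p q).Reachable (.inl i) (upper v) ∧
            ∃ b, (diagram p.1 p.1).graph.Adj v b) ↔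
            ((pathStack p q).Reachable (.inl i) (upper w) ∧
              ∃ b, (diagram p.1 p.1).graph.Adj w b) :=
          ⟨fun h => ⟨h.1.trans e1, v, hvw.symm⟩, fun h => ⟨h.1.trans e1.symm, w, hvw⟩⟩
        simp only [α, this])
    have hβ := total_eq_zero (diagram q.1 q.1) β
      (fun v hv => by
        by_contra hn
        exact hv (if_neg fun h => hn h.2))
      (fun v w hvw => by
        have e1 := (stack_adj_lower (diagram p.1 p.1) (diagram q.1 q.1) hvw).reachable
        have : ((pathStack p q).Reachable (.inl i) (lower v) ∧
            ∃ b, (diagram q.1 q.1).graph.Adj v b) ↔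
            ((pathStack p q).Reachable (.inl i) (lower w) ∧
              ∃ b, (diagram q.1 q.1).graph.Adj w b) :=
          ⟨fun h => ⟨h.1.trans e1, v, hvw.symm⟩, fun h => ⟨h.1.trans e1.symm, w, hvw⟩⟩
        simp only [β, this])
    rw [Fintype.sum_sum_type] at hα hβ
    have hlab : boundaryColor o d p q (.inl i) = d (whitesBefore p.1 i) := if_pos hi
    have hlab' : d (whitesBefore p.1 i) ≠ o := ho _ (whitesBefore_lt p hi)
    -- A middle vertex isolated in one of the diagrams would force the colour `o`, which is not a
    -- label.
    have hmid : ∀ j, α (.inr j) = β (.inl j) := by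
      intro j
      have e : upper (.inr j) = lower (.inl j) := rfl
      simp only [α, β, e]
      by_cases hr : (pathStack p q).Reachable (.inl i) (lower (.inl j))
      · have : ¬ (p.1 j = 0 ∨ q.1 j = 0) := by
          rw [← mid_mem_boundary j]
          intro hj
          exact hlab' (hlab.symm.trans (hconst _ (top_mem_boundary i) _ hj hr))
        push Not at this
        rw [if_pos ⟨hr, (exists_adj_inr_iff j).2 this.1⟩,
          if_pos ⟨hr, (exists_adj_inl_iff j).2 this.2⟩]
      · rw [if_neg fun h => hr h.1, if_neg fun h => hr h.1]
    -- A second top vertex on the strand cannot lie on an arc, since that would give a third end,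
    -- and cannot be white, since it would carry a different label.
    have htop : ∑ j, α (.inl j) = 1 := by
      rw [Finset.sum_eq_single i]
      · exact if_pos ⟨SimpleGraph.Reachable.refl _, .inr i, hi, hi, rfl⟩
      · intro j _ hj
        refine if_neg ?_
        rintro ⟨hr, b | b, hb⟩
        · have e1 : (pathStack p q).Reachable (.inl j) (.inl b) :=
            (stack_adj_upper (diagram p.1 p.1) (diagram q.1 q.1) hb).reachable
          have e2 := end_unique _ _ (isEnd_outer _ _ (.inl j)) (isEnd_outer _ _ (.inl b))
            (isEnd_outer _ _ (.inl i)) (fun e => (Arc.ne hb) (Sum.inl_injective e))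
            (fun e => hj (Sum.inl_injective e)) e1 hr.symm
          obtain rfl : b = i := Sum.inl_injective e2
          exact White.not_arc hi (Arc.symm hb)
        · have e1 := hconst _ (top_mem_boundary i) _ (top_mem_boundary j) hr
          have e2 : boundaryColor o d p q (.inl j) = d (whitesBefore p.1 j) := if_pos hb.1
          rw [hlab, e2] at e1
          exact hj (White.eq_of hb.1 hi (hd (whitesBefore_lt p hi) (whitesBefore_lt p hb.1) e1).symm)
      · simp
    have hbot : ∑ j, β (.inr j) ≠ 0 := by
      intro h0
      rw [h0, add_zero] at hβ
      simp only [hmid, hβ, htop, add_zero] at hα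
      exact one_ne_zero hα
    obtain ⟨j, -, hj⟩ := Finset.exists_ne_zero_of_sum_ne_zero hbot
    refine ⟨j, by simp, ?_⟩
    by_contra hn
    exact hj (if_neg fun h => hn h.1)
  -- Every white top vertex now starts a vertical edge, so the rank is at least r.
  refine (comp_eq_or_rank_lt p q).resolve_right (not_lt.2 ?_)
  choose! f hf using hex
  rw [Diagram.rank]
  refine (card_white p).ge.trans ?_
  refine Set.ncard_le_ncard_of_injOn (fun i => (i, f i)) (fun i hi => hf i hi) ?_ (Set.toFinite _)
  intro i _ j _ h
  exact congrArg Prod.fst h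

open Classical in
/-- The value of the form at `x = card Γ` counts colourings. -/
theorem card_colors_eq (hd : Set.InjOn d (Set.Iio r)) (ho : ∀ n < r, d n ≠ o) :
    Nat.card {c : Fin k → Γ // Colors o d p.1 c ∧ Colors o d q.1 c} =
      if comp (diagram p.1 p.1) (diagram q.1 q.1) = diagram p.1 q.1 then
        Nat.card Γ ^ loops (diagram p.1 p.1) (diagram q.1 q.1) else 0 := by
  rw [card_colors]
  split_ifs with h
  -- The components with a free colour are those without boundary vertices, which are the closed
  -- loops.
  · rw [card_extensions _ _ _ (exists_coloring p q h)]
    congr 2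
    ext C
    refine forall_congr' fun v => ?_
    rw [boundary, Set.mem_ofPred_eq, not_not, SimpleGraph.ConnectedComponent.mem_supp_iff]
  · have : IsEmpty {κ : (pathStack p q).ConnectedComponent → Γ //
      ∀ v ∈ boundary p q, κ ((pathStack p q).connectedComponentMk v) =
        boundaryColor o d p q v} :=
      ⟨fun κ => h (comp_eq_of_coloring p q hd ho ⟨κ.1, κ.2⟩)⟩
    exact Nat.card_of_isEmpty

end Colorings

/-! ### The Gram determinant at an integer number of colours -/

section Gram

variable {R : Type*} [CommRing R] {k r : ℕ}

open Classical in
theorem gramMatrix_eq (x : R) (p q : MotzkinPath k r) : gramMatrix x k r p q =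
    if comp (diagram p.1 p.1) (diagram q.1 q.1) = diagram p.1 q.1 then
      x ^ loops (diagram p.1 p.1) (diagram q.1 q.1) else 0 := by
  rw [gramMatrix_apply, cellForm_single, pathDiagram, pathDiagram, mul_single,
    Finsupp.single_apply]

theorem gramMatrix_map {S : Type*} [CommRing S] (f : R →+* S) (x : R) :
    (gramMatrix x k r).map f = gramMatrix (f x) k r := by
  ext p q
  rw [Matrix.map_apply, gramMatrix_eq, gramMatrix_eq]
  split_ifs
  · exact map_pow f _ _
  · exact map_zero f

theorem map_det_gramMatrix {S : Type*} [CommRing S] (f : R →+* S) (x : R) :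
    f (gramMatrix x k r).det = (gramMatrix (f x) k r).det := by
  rw [RingHom.map_det, RingHom.mapMatrix_apply, gramMatrix_map]

/-- The Gram determinant at a large number of colours. -/
theorem det_gramMatrix_card {Γ : Type*} [Fintype Γ] [DecidableEq Γ] {F : Type*} [Field F]
    {u : ℕ → F} (hu : IsChebyshev Γ u) {o : Γ} {d : ℕ → Γ} (hd : Set.InjOn d (Set.Iio r))
    (ho : ∀ n < r, d n ≠ o) : (gramMatrix (Fintype.card Γ : F) k r).det =
      ∏ p : MotzkinPath k r, normSq u k p.1 := by
  classical
  rw [← det_pathVec hu (delta_mem_harmonic hd ho) (wordForm_delta r)]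
  congr 1
  ext p q
  have hp := (isPath_iff p.1 r).2 p.2
  have hq := (isPath_iff q.1 r).2 q.2
  have key := card_colors_eq p q hd ho
  simp only [← compatible_iff_colors o d hp, ← compatible_iff_colors o d hq] at key
  rw [Matrix.of_apply, gramMatrix_eq]
  simp only [pathVec_delta hp, pathVec_delta hq, ite_zero_mul_ite_zero, mul_one]
  rw [Nat.card_eq_fintype_card, Nat.card_eq_fintype_card] at key
  rw [Finset.sum_boole, ← Fintype.card_subtype, key]
  push_cast
  rfl

end Gram

/-! ### The product of the squared lengths -/

section Count

variable {k r : ℕ}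

theorem MotzkinPath.isPath (p : MotzkinPath k r) : IsPath p.1 r := (isPath_iff p.1 r).2 p.2

/-- A path of rank `r` as an element of the type of Motzkin paths. -/
def IsPath.toPath {a : Fin k → SignType} (h : IsPath a r) : MotzkinPath k r :=
  ⟨a, (isPath_iff a r).1 h⟩

theorem IsPath.le {a : Fin k → SignType} (h : IsPath a r) : r ≤ k := by
  have : ∀ n ≤ k, height a n ≤ n := by
    intro n
    induction n with
    | zero => simp [height_zero]
    | succ n ih =>
      intro hn
      have h1 := ih (by omega)
      have h2 := height_step a (n := n) (by omega)
      push_cast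
      omega
  have := this k le_rfl
  rw [h.2] at this
  omega

theorem numPaths_eq_zero (h : k < r) : numPaths k r = 0 := by
  rw [numPaths, Fintype.card_eq_zero_iff]
  exact ⟨fun p => absurd p.isPath.le (by omega)⟩

/-- A nonempty path of positive rank is determined by its last step and the path before it. -/
noncomputable def pathEquiv (k r : ℕ) : MotzkinPath k r ⊕ MotzkinPath k (r + 1) ⊕
    MotzkinPath k (r + 2) ≃ MotzkinPath (k + 1) (r + 1) :=
  Equiv.ofBijective (Sum.elim (fun p => p.isPath.up.toPath)
    (Sum.elim (fun p => p.isPath.level.toPath) fun p => p.isPath.down.toPath)) <| by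
    constructor
    · have h10 : (1 : SignType) ≠ 0 := by decide
      have h12 : (1 : SignType) ≠ -1 := by decide
      have h02 : (0 : SignType) ≠ -1 := by decide
      rintro (p | p | p) (q | q | q) h <;>
        simp only [Sum.elim_inl, Sum.elim_inr, IsPath.toPath, Subtype.mk.injEq] at h <;>
        have h1 := congrArg Fin.init h <;> have h2 := congrFun h (Fin.last k) <;>
        simp only [Fin.init_snoc, Fin.snoc_last, h10, h12, h02, h10.symm, h12.symm, h02.symm,
          Subtype.ext_iff.symm] at h1 h2 <;> rw [h1]
    · intro p
      rcases p.isPath.cases with ⟨e, n, hn, h⟩ | ⟨e, h⟩ | ⟨e, h⟩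
      · obtain rfl : r = n := by omega
        refine ⟨.inl h.toPath, Subtype.ext ?_⟩
        exact (congrArg (Fin.snoc _) e.symm).trans (Fin.snoc_init_self p.1)
      · refine ⟨.inr (.inl h.toPath), Subtype.ext ?_⟩
        exact (congrArg (Fin.snoc _) e.symm).trans (Fin.snoc_init_self p.1)
      · refine ⟨.inr (.inr h.toPath), Subtype.ext ?_⟩
        exact (congrArg (Fin.snoc _) e.symm).trans (Fin.snoc_init_self p.1)

/-- A nonempty path of rank `0` is determined by its last step and the path before it. -/
noncomputable def pathEquivZero (k : ℕ) : MotzkinPath k 0 ⊕ MotzkinPath k 1 ≃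
    MotzkinPath (k + 1) 0 :=
  Equiv.ofBijective (Sum.elim (fun p => p.isPath.level.toPath) fun p => p.isPath.down.toPath) <| by
    constructor
    · have h02 : (0 : SignType) ≠ -1 := by decide
      rintro (p | p) (q | q) h <;>
        simp only [Sum.elim_inl, Sum.elim_inr, IsPath.toPath, Subtype.mk.injEq] at h <;>
        have h1 := congrArg Fin.init h <;> have h2 := congrFun h (Fin.last k) <;>
        simp only [Fin.init_snoc, Fin.snoc_last, h02, h02.symm,
          Subtype.ext_iff.symm] at h1 h2 <;> rw [h1]
    · intro p
      rcases p.isPath.cases with ⟨e, n, hn, h⟩ | ⟨e, h⟩ | ⟨e, h⟩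
      · omega
      · refine ⟨.inl h.toPath, Subtype.ext ?_⟩
        exact (congrArg (Fin.snoc _) e.symm).trans (Fin.snoc_init_self p.1)
      · refine ⟨.inr h.toPath, Subtype.ext ?_⟩
        exact (congrArg (Fin.snoc _) e.symm).trans (Fin.snoc_init_self p.1)

theorem numPaths_succ (k r : ℕ) : numPaths (k + 1) (r + 1) =
    numPaths k r + numPaths k (r + 1) + numPaths k (r + 2) := by
  rw [numPaths, ← Fintype.card_congr (pathEquiv k r), Fintype.card_sum, Fintype.card_sum, add_assoc]
  rfl

variable {F : Type*} [Field F]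

/-- The product of the squared norms of the orthogonal basis. -/
noncomputable def normProd (u : ℕ → F) (k r : ℕ) : F := ∏ p : MotzkinPath k r, normSq u k p.1

variable (u : ℕ → F)

theorem normSq_snoc_of_ne {a : Fin k → SignType} {e : SignType} (he : e ≠ -1) :
    normSq u (k + 1) (Fin.snoc a e : Fin (k + 1) → SignType) = normSq u k a := by
  rw [normSq, Fin.init_snoc, Fin.snoc_last, if_neg he, mul_one]

theorem normSq_snoc_down {a : Fin k → SignType} (h : IsPath a (r + 1)) :
    normSq u (k + 1) (Fin.snoc a (-1) : Fin (k + 1) → SignType) =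
      normSq u k a * (u (r + 1) / u r) := by
  rw [normSq, Fin.init_snoc, Fin.snoc_last, if_pos rfl, h.down.height_toNat]

theorem prod_normSq_down (k r : ℕ) : ∏ p : MotzkinPath k (r + 1),
    normSq u (k + 1) (Fin.snoc p.1 (-1) : Fin (k + 1) → SignType) =
      normProd u k (r + 1) * (u (r + 1) / u r) ^ numPaths k (r + 1) := by
  rw [Finset.prod_congr rfl fun p _ => normSq_snoc_down u p.isPath, Finset.prod_mul_distrib,
    Finset.prod_const, Finset.card_univ]
  rfl

/-- The three blocks are the paths with last step up, level and down; only the last block acquires a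
new factor. -/
theorem normProd_succ (k r : ℕ) : normProd u (k + 1) (r + 1) =
    normProd u k r * normProd u k (r + 1) *
      (normProd u k (r + 2) * (u (r + 2) / u (r + 1)) ^ numPaths k (r + 2)) := by
  rw [normProd, ← (pathEquiv k r).prod_comp, Fintype.prod_sum_type, Fintype.prod_sum_type,
    ← prod_normSq_down, ← mul_assoc]
  congr 2
  · exact Finset.prod_congr rfl fun p _ => normSq_snoc_of_ne u (by decide)
  · exact Finset.prod_congr rfl fun p _ => normSq_snoc_of_ne u (by decide)

theorem normProd_succ_zero (k : ℕ) : normProd u (k + 1) 0 =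
    normProd u k 0 * (normProd u k 1 * (u 1 / u 0) ^ numPaths k 1) := by
  rw [normProd, ← (pathEquivZero k).prod_comp, Fintype.prod_sum_type, ← prod_normSq_down]
  congr 1
  exact Finset.prod_congr rfl fun p _ => normSq_snoc_of_ne u (by decide)

theorem normProd_zero (r : ℕ) : normProd u 0 r = 1 :=
  Finset.prod_eq_one fun _ _ => rfl

/-- Multiplication by φ(s+1)/φ(s) raises the index of the numerator in the s-th factor of the first
product; the same ratio with exponent e(s+1) is borrowed from the second product and passed on. What
is left over at M is the last factor on the right. -/
theorem prod_telescope {φ g : ℕ → F} (hφ : ∀ n, φ n ≠ 0) (e : ℕ → ℕ) (M : ℕ) :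
    (∏ s ∈ Finset.range M, (φ s / g s) ^ e s) *
        (∏ s ∈ Finset.range M, (φ (s + 2) / g s) ^ e (s + 1)) * (φ 1 / φ 0) ^ e 0 =
      (∏ s ∈ Finset.range M, (φ (s + 1) / g s) ^ (e s + e (s + 1))) *
        (φ (M + 1) / φ M) ^ e M := by
  induction M with
  | zero => simp
  | succ M ih =>
    simp only [Finset.prod_range_succ, pow_add]
    have h1 : (φ M / g M) ^ e M * (φ (M + 1) / φ M) ^ e M = (φ (M + 1) / g M) ^ e M := by
      rw [← mul_pow]
      congr 1
      rw [mul_comm, div_mul_div_cancel₀ (hφ M)]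
    have h2 : (φ (M + 1) / g M) ^ e (M + 1) * (φ (M + 2) / φ (M + 1)) ^ e (M + 1) =
        (φ (M + 2) / g M) ^ e (M + 1) := by
      rw [← mul_pow]
      congr 1
      rw [mul_comm, div_mul_div_cancel₀ (hφ (M + 1))]
    rw [← h2]
    simp only [pow_add] at ih
    linear_combination (φ M / g M) ^ e M * ((φ (M + 1) / g M) ^ e (M + 1) *
      (φ (M + 2) / φ (M + 1)) ^ e (M + 1)) * ih +
      (∏ s ∈ Finset.range M, (φ (s + 1) / g s) ^ e s * (φ (s + 1) / g s) ^ e (s + 1)) *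
      ((φ (M + 1) / g M) ^ e (M + 1) * (φ (M + 2) / φ (M + 1)) ^ e (M + 1)) * h1

/-- The product formula for the determinant. -/
theorem normProd_eq {u : ℕ → F} (hu : ∀ n, u n ≠ 0) (k r M : ℕ) (h : k ≤ r + 2 * M + 1) :
    normProd u k r =
      ∏ s ∈ Finset.range M, (u (s + 1 + r) / u s) ^ numPaths k (r + 2 * (s + 1)) := by
  induction k generalizing r with
  | zero =>
    rw [normProd_zero]
    refine (Finset.prod_eq_one fun s _ => ?_).symm
    rw [numPaths_eq_zero (by omega), pow_zero]
  | succ k ih =>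
    -- The two products on the left are those for rank r - 1 and r + 1, and the extra factor comes
    -- from the final down-steps. M stays fixed in the induction: the bound for k + 1 and r gives
    -- the bound for k at the ranks r - 1, r and r + 1.
    have key := prod_telescope (φ := fun n => u (n + r)) (g := u) (fun n => hu _)
      (fun s => numPaths k (r + 2 * s + 1)) M
    have h3 : ∀ s, numPaths (k + 1) (r + 2 * (s + 1)) = numPaths k (r + 2 * s + 1) +
        numPaths k (r + 2 * (s + 1) + 1) + numPaths k (r + 2 * (s + 1)) := by
      intro s
      have := numPaths_succ k (r + 2 * s + 1)
      rw [show r + 2 * (s + 1) = r + 2 * s + 1 + 1 by ring, this]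
      ring
    simp only [h3, pow_add _ (_ + _) (numPaths k _), Finset.prod_mul_distrib (g := fun s =>
      (u (s + 1 + r) / u s) ^ numPaths k (r + 2 * (s + 1)))]
    -- The leftover factor has exponent zero, since no path of length k reaches the height r + 2M +
    -- 1.
    simp only [numPaths_eq_zero (show k < r + 2 * M + 1 by omega), pow_zero, mul_one, mul_zero,
      add_zero, zero_add] at key
    rw [← key, ← ih r (by omega)]
    have e1 := ih (r + 1) (by omega)
    have e1' : normProd u k (r + 1) = ∏ s ∈ Finset.range M,
        (u (s + 2 + r) / u s) ^ numPaths k (r + 2 * (s + 1) + 1) := by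
      rw [e1]
      refine Finset.prod_congr rfl fun s _ => ?_
      rw [show s + 1 + (r + 1) = s + 2 + r by ring,
        show r + 1 + 2 * (s + 1) = r + 2 * (s + 1) + 1 by ring]
    rw [← e1']
    -- For r = 0 no path ends with an up-step, and accordingly the first product is 1 because each
    -- of its quotients is u_s/u_s.
    cases r with
    | zero =>
      have : ∏ s ∈ Finset.range M, (u (s + 0) / u s) ^ numPaths k (0 + 2 * s + 1) = 1 := by
        refine Finset.prod_eq_one fun s _ => ?_
        rw [add_zero, div_self (hu s), one_pow]
      rw [this, normProd_succ_zero]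
      simp only [zero_add, add_zero]
      ring
    | succ r =>
      have : normProd u k r = ∏ s ∈ Finset.range M,
          (u (s + (r + 1)) / u s) ^ numPaths k (r + 1 + 2 * s + 1) := by
        rw [ih r (by omega)]
        refine Finset.prod_congr rfl fun s _ => ?_
        rw [show s + 1 + r = s + (r + 1) by ring,
          show r + 2 * (s + 1) = r + 1 + 2 * s + 1 by ring]
      rw [← this, normProd_succ, add_comm 1 (r + 1)]
      ring

end Count

/-! ### Nonvanishing of Chebyshev polynomials -/

section Chebyshev

/-- Monotonicity is carried along in the induction: u_{n+2} ≥ 2u_{n+1} - u_n ≥ u_{n+1} once u_{n+1}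
is positive and at least u_n. -/
theorem eval_S_pos {m : ℚ} (hm : 2 ≤ m) (n : ℕ) : 0 < (Chebyshev.S ℚ n).eval m ∧
    (Chebyshev.S ℚ n).eval m ≤ (Chebyshev.S ℚ ((n : ℤ) + 1)).eval m := by
  induction n with
  | zero => simp; linarith
  | succ n ih =>
    have e : (Chebyshev.S ℚ (((n + 1 : ℕ) : ℤ) + 1)).eval m =
        m * (Chebyshev.S ℚ ((n : ℤ) + 1)).eval m - (Chebyshev.S ℚ n).eval m := by
      rw [show ((n + 1 : ℕ) : ℤ) + 1 = (n : ℤ) + 2 by push_cast; ring, Chebyshev.S_add_two]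
      simp
    rw [e]
    push_cast
    obtain ⟨h1, h2⟩ := ih
    refine ⟨h1.trans_le h2, ?_⟩
    nlinarith

theorem isChebyshev_S {m : ℕ} (hm : 2 ≤ m) :
    IsChebyshev (Fin (m + 1)) fun n : ℕ => (Chebyshev.S ℚ n).eval (m : ℚ) where
  zero := by simp
  one := by simp
  add_two n := by
    push_cast
    rw [Chebyshev.S_add_two]
    simp
  ne_zero n := (eval_S_pos (by exact_mod_cast hm) n).1.ne'

/-- Being monic keeps the denominators nonzero as polynomials in every characteristic. Two
consecutive indices are treated together because the recursion has order two. -/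
theorem monic_S (R : Type*) [CommRing R] [Nontrivial R] (n : ℕ) :
    (Chebyshev.S R n).Monic ∧ (Chebyshev.S R n).natDegree = n ∧
      (Chebyshev.S R ((n : ℤ) + 1)).Monic ∧ (Chebyshev.S R ((n : ℤ) + 1)).natDegree = n + 1 := by
  induction n with
  | zero => simp [monic_X]
  | succ n ih =>
    obtain ⟨h1, h2, h3, h4⟩ := ih
    have e : Chebyshev.S R (((n + 1 : ℕ) : ℤ) + 1) =
        X * Chebyshev.S R ((n : ℤ) + 1) - Chebyshev.S R n := by
      rw [show ((n + 1 : ℕ) : ℤ) + 1 = (n : ℤ) + 2 by push_cast; ring, Chebyshev.S_add_two]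
    have hX : (X * Chebyshev.S R ((n : ℤ) + 1)).Monic := monic_X.mul h3
    have hd : (X * Chebyshev.S R ((n : ℤ) + 1)).natDegree = n + 2 := by
      rw [monic_X.natDegree_mul h3, natDegree_X, h4]
      ring
    have hlt : (Chebyshev.S R n).natDegree < (X * Chebyshev.S R ((n : ℤ) + 1)).natDegree := by
      omega
    rw [e]
    push_cast
    refine ⟨h3, h4, hX.sub_of_left (degree_lt_degree hlt), ?_⟩
    rw [natDegree_sub_eq_left_of_natDegree_lt hlt, hd]

theorem S_comp_ne_zero (K : Type*) [Field K] (n : ℕ) :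
    (Chebyshev.S K n).comp (X - 1) ≠ 0 := by
  intro h
  have := congrArg (fun p : K[X] => p.comp (X + 1)) h
  simp only [comp_assoc, sub_comp, X_comp, one_comp, add_sub_cancel_right, comp_X,
    zero_comp] at this
  exact (monic_S K n).1.ne_zero this

end Chebyshev

/-! ### From integer values to the polynomial identity -/

theorem det_gramMatrix_nat (k r : ℕ) {m : ℕ} (hm : 2 ≤ m) (hr : r ≤ m) :
    (gramMatrix (((m + 1 : ℕ) : ℚ)) k r).det =
      ∏ s ∈ Finset.range ((k - r) / 2), ((Chebyshev.S ℚ ((s + 1 + r : ℕ) : ℤ)).eval (m : ℚ) /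
        (Chebyshev.S ℚ (s : ℤ)).eval (m : ℚ)) ^ numPaths k (r + 2 * (s + 1)) := by
  have hu := isChebyshev_S hm
  have h := det_gramMatrix_card (k := k) (r := r) hu (o := 0)
    -- The labels are 1, …, r, which avoid the colour 0; r ≤ m leaves enough colours for them to be
    -- distinct.
    (d := fun n => Fin.ofNat (m + 1) (n + 1)) ?_ ?_
  · rw [Fintype.card_fin] at h
    rw [h]
    exact normProd_eq hu.ne_zero k r _ (by omega)
  · intro i hi j hj hij
    rw [Set.mem_Iio] at hi hj
    have := congrArg Fin.val hij
    simp only [Fin.val_ofNat] at this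
    rw [Nat.mod_eq_of_lt (by omega), Nat.mod_eq_of_lt (by omega)] at this
    omega
  · intro n hn hn0
    have := congrArg Fin.val hn0
    simp only [Fin.val_ofNat, Fin.val_zero] at this
    rw [Nat.mod_eq_of_lt (by omega)] at this
    omega

/-- The determinant formula with cleared denominators. -/
theorem det_gramMatrix_mul (R : Type*) [CommRing R] (k r : ℕ) :
    (gramMatrix (X : R[X]) k r).det *
        ∏ s ∈ Finset.range ((k - r) / 2),
          ((Chebyshev.S R (s : ℤ)).comp (X - 1)) ^ numPaths k (r + 2 * (s + 1)) =
      ∏ s ∈ Finset.range ((k - r) / 2),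
        ((Chebyshev.S R ((s + 1 + r : ℕ) : ℤ)).comp (X - 1)) ^ numPaths k (r + 2 * (s + 1)) := by
  have key : (gramMatrix (X : ℤ[X]) k r).det *
        ∏ s ∈ Finset.range ((k - r) / 2),
          ((Chebyshev.S ℤ (s : ℤ)).comp (X - 1)) ^ numPaths k (r + 2 * (s + 1)) =
      ∏ s ∈ Finset.range ((k - r) / 2),
        ((Chebyshev.S ℤ ((s + 1 + r : ℕ) : ℤ)).comp (X - 1)) ^ numPaths k (r + 2 * (s + 1)) := by
    apply eq_of_infinite_eval_eq
    -- The sample points are m + 1 with m = n + 2 + r, which ensures m ≥ 2 and m ≥ r.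
    refine Set.Infinite.mono ?_ (Set.infinite_range_of_injective
      (f := fun n : ℕ => ((n + 2 + r + 1 : ℕ) : ℤ)) fun a b h => by simpa using h)
    rintro _ ⟨n, rfl⟩
    rw [Set.mem_ofPred_eq]
    apply Int.cast_injective (α := ℚ)
    let ψ : ℤ[X] →+* ℚ := (Int.castRingHom ℚ).comp (evalRingHom ((n + 2 + r + 1 : ℕ) : ℤ))
    have hψX : ψ X = ((n + 2 + r + 1 : ℕ) : ℚ) := by
      simp only [ψ, RingHom.comp_apply, coe_evalRingHom, eval_X]
      simp
    have hψS : ∀ j : ℤ, ψ ((Chebyshev.S ℤ j).comp (X - 1)) =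
        (Chebyshev.S ℚ j).eval ((n + 2 + r : ℕ) : ℚ) := by
      intro j
      simp only [ψ, RingHom.comp_apply, coe_evalRingHom, eval_comp, eval_sub, eval_X, eval_one]
      rw [← Chebyshev.map_S (Int.castRingHom ℚ) j, ← Int.cast_natCast (n + 2 + r),
        eval_intCast_map, Nat.cast_succ (n + 2 + r), add_sub_cancel_right]
      rfl
    change ψ _ = ψ _
    rw [map_mul, map_det_gramMatrix, hψX, map_prod, map_prod,
      det_gramMatrix_nat k r (by omega) (by omega), ← Finset.prod_mul_distrib]
    refine Finset.prod_congr rfl fun s _ => ?_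
    rw [map_pow, map_pow, hψS, hψS, ← mul_pow, div_mul_cancel₀]
    exact (isChebyshev_S (m := n + 2 + r) (by omega)).ne_zero s
  -- Without denominators the integral identity passes to any commutative ring.
  have := congrArg (mapRingHom (Int.castRingHom R)) key
  simp only [map_mul, map_prod, map_pow, map_det_gramMatrix, coe_mapRingHom, map_X, Polynomial.map_comp,
    Chebyshev.map_S, Polynomial.map_sub, Polynomial.map_one] at this
  exact this

end Motzkin

theorem mainTheorem3 {K : Type*} [Field K] (k r : ℕ) (hk : 0 < k) (hr : r ≤ k) :
    ∃ P : K[X],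
      algebraMap K[X] (RatFunc K) P =
        ∏ s ∈ Finset.Icc 1 ((k - r) / 2),
          (algebraMap K[X] (RatFunc K) ((Chebyshev.S K ((s : ℤ) + r)).comp (X - 1)) /
            algebraMap K[X] (RatFunc K) ((Chebyshev.S K ((s : ℤ) - 1)).comp (X - 1))) ^
              Motzkin.numPaths k (r + 2 * s) ∧
      ∀ x : K,
        (Motzkin.gramMatrix x k r).det = P.eval x ∧
        ((∀ s ∈ Finset.Icc 1 ((k - r) / 2), (Chebyshev.S K ((s : ℤ) - 1)).eval (x - 1) ≠ 0) →
          (Motzkin.gramMatrix x k r).det =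
            ∏ s ∈ Finset.Icc 1 ((k - r) / 2),
              ((Chebyshev.S K ((s : ℤ) + r)).eval (x - 1) /
                (Chebyshev.S K ((s : ℤ) - 1)).eval (x - 1)) ^
                  Motzkin.numPaths k (r + 2 * s)) := by
  have hIcc : Finset.Icc 1 ((k - r) / 2) =
      (Finset.range ((k - r) / 2)).map (addRightEmbedding 1) := by
    ext s
    simp only [Finset.mem_Icc, Finset.mem_map, Finset.mem_range, addRightEmbedding_apply]
    exact ⟨fun h => ⟨s - 1, by omega, by omega⟩, by rintro ⟨a, h, rfl⟩; omega⟩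
  have key := Motzkin.det_gramMatrix_mul K k r
  -- The product starts at 1 in the statement and at 0 in the identity with cleared denominators.
  have e1 : ∀ s : ℕ, (((s + 1 : ℕ) : ℤ) + r) = ((s + 1 + r : ℕ) : ℤ) := fun s => by push_cast; ring
  have e2 : ∀ s : ℕ, (((s + 1 : ℕ) : ℤ) - 1) = (s : ℤ) := fun s => by push_cast; ring
  have heval : ∀ x : K, (Motzkin.gramMatrix x k r).det =
      (Motzkin.gramMatrix (X : K[X]) k r).det.eval x := by
    intro x
    rw [← coe_evalRingHom, Motzkin.map_det_gramMatrix, coe_evalRingHom, eval_X]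
  refine ⟨(Motzkin.gramMatrix (X : K[X]) k r).det, ?_, fun x => ⟨heval x, fun hx => ?_⟩⟩
  · simp only [hIcc, Finset.prod_map, addRightEmbedding_apply, e1, e2, div_pow,
      Finset.prod_div_distrib]
    rw [eq_div_iff]
    · simpa only [map_mul, map_prod, map_pow] using congrArg (algebraMap K[X] (RatFunc K)) key
    · refine Finset.prod_ne_zero_iff.2 fun s _ => pow_ne_zero _ ?_
      exact (map_ne_zero_iff _ (RatFunc.algebraMap_injective K)).2 (Motzkin.S_comp_ne_zero K s)
  · simp only [hIcc, Finset.prod_map, addRightEmbedding_apply, e1, e2, div_pow,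
      Finset.prod_div_distrib, Finset.forall_mem_map] at hx ⊢
    rw [eq_div_iff, heval]
    · simpa only [eval_mul, eval_prod, eval_pow, eval_comp, eval_sub, eval_X, eval_one]
        using congrArg (eval x) key
    · exact Finset.prod_ne_zero_iff.2 fun s hs => pow_ne_zero _ (hx s hs)
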